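/- **Theorem 5 (Rate of CD$_q$).** Let $A,E,\beta,\gamma>0$ (peak intensity, average intensity, bias, scaling), $Q(x)=\frac1{\sqrt{2\pi}}\int_x^\infty e^{-u^2/2}\,du$, $\bar\epsilon=2Q(\beta)$, $N=\lceil\log_2(\gamma(A+2\beta))\rceil$, and $1\le q\le N-1$. *Channel.* In each channel use the input is $x=(X_0^b,\dots,X_{N-1}^b)\in\{0,1\}^N$. The noise vector $(Z_0^b,\dots,Z_{N-1}^b)$ is independent of the input and has the law $$P\{Z^b=z\}=\frac1T\sum_{k}\Big[Q\big(\tfrac{k-\gamma\beta}{\gamma}\big)-Q\big(\tfrac{k+1-\gamma\beta}{\gamma}\big)\Big],$$ where the sum is over the integers $-\lceil\gamma A\rceil\le k\le\lceil\gamma(A+2\beta)\rceil-1$ whose $N$-bit representation (that of $2^N+k$ if $k<0$; least significant bit first) is $z$, and $T=Q\big(\tfrac{-\lceil\gamma A\rceil-\gamma\beta}{\gamma}\big)-Q\big(\tfrac{\lceil\gamma(A+2\beta)\rceil-\gamma\beta}{\gamma}\big)$. The carry-over bits are $W_0^b=0$, $W_{i+1}^b=(X_i^bZ_i^b+X_i^bW_i^b+Z_i^bW_i^b)\bmod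 2$. Given the input $x$, the whole output is erased with probability $e(x)$, independently of the noise; here $e$ is any function with $0\le e(x)\le\bar\epsilon$ for all $x$ with $\sum_i x_i2^i\le\gamma A$ (the case $e\equiv\bar\epsilon$ is the vector binary channel VBC$_{\bar\epsilon}$). The output is $Y_i^c=\xi$ for all $i$ if erased, and $Y_i^c=(X_i^b+Z_i^b+W_i^b)\bmod 2$, $0\le i\le N-1$, otherwise; $Y_i^c=0$ for $i\ge N$. The channel is memoryless. Put $\bar Y_i^c=(Y_i^c+W_i^b)\bmod2$ if $Y_i^c\ne\xi$, and $\bar Y_i^c=\xi$ otherwise. *Scheme CD$_q$.* The message is split into $m_0,\dots,m_{N-1}$, and $m_i$ is encoded by a separate binary block code of length $n$ on bit-pipe $i$. Only bit-pipes from a set $\mathcal V$ with $\sum_{i\in\mathcal V}2^i\le\gamma A$ are used (the others send $0$), and every transmitted block satisfies $\frac1n\sum_t\sum_iX_i^b(t)2^i\le\gamma E$. The receiver decodes $m_0,m_1,\dots,m_{N-1}$ in this order; $m_i$ is decoded from $(\bar Y_i^c(t),Y_{i+1}^c(t),\dots,Y_{i+q}^c(t))$, $t=1,\dots,n$, only,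 with the carry-over bits in $\bar Y_i^c$ computed from the messages decoded before. The scheme achieves the rate $R$ if for every $\delta>0$ and all large $n$ there is such a code with total rate at least $R-\delta$ bits per channel use and with probability at most $\delta$ (uniform messages) that some message is decoded wrongly. *Claim.* The CD$_q$ scheme achieves the rate $$R_{\mathrm{CD}_q}=(1-\bar\epsilon)\,\max_{p}\ \sum_{i=0}^{N-1} I\big(X_i^b;\bar Y_i^c,Y_{i+1}^c,\dots,Y_{i+q}^c\,\big|\,\bar Y_i^c\ne\xi\big),$$ where the mutual information (in bits) is computed, conditionally on the event $\bar Y_i^c\ne\xi$, for independent input bits $X_j^b\sim\mathrm{Bern}(p_j)$, and the maximum, which exists, is over $p\in[0,1]^N$ with $\sum_{i:\,p_i>0}2^i\le\gamma A$ and $\sum_{i:\,p_i>0}p_i2^i\le\gamma E$. -/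

import Mathlib

namespace VBC

noncomputable section

/-! ### Mutual information on a finite probability space (in bits) -/

/-- Probability of the event `{f = a}` under the weights `μ`. -/
def prob {Ω α : Type*} [Fintype Ω] [DecidableEq α] (μ : Ω → ℝ) (f : Ω → α) (a : α) : ℝ :=
  ∑ ω with f ω = a, μ ω

/-- Mutual information `I(f; g)`, in bits, of two finitely valued random variables under `μ`
(terms of probability zero contribute zero). -/
def mutualInfo {Ω α α' : Type*} [Fintype Ω] [Fintype α] [Fintype α'] [DecidableEq α]
    [DecidableEq α'] (μ : Ω → ℝ) (f : Ω → α) (g : Ω → α') : ℝ :=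
  ∑ a, ∑ b, prob μ (fun ω => (f ω, g ω)) (a, b) *
    Real.logb 2 (prob μ (fun ω => (f ω, g ω)) (a, b) / (prob μ f a * prob μ g b))

/-- The law `μ` conditioned on the event `S`. -/
def condLaw {Ω : Type*} [Fintype Ω] (μ : Ω → ℝ) (S : Ω → Prop) [DecidablePred S] : Ω → ℝ :=
  fun ω => if S ω then μ ω / ∑ ω' with S ω', μ ω' else 0

/-! ### The vector binary channel with erasures -/

/-- Standard Gaussian tail function `Q`. -/
def gaussQ (x : ℝ) : ℝ :=
  (1 / Real.sqrt (2 * Real.pi)) * ∫ u in Set.Ioi x, Real.exp (-u ^ 2 / 2)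

/-- The `N`-bit representation of the integer `k`, two's complement (`2^N + k`) for `k < 0`;
index `0` is the least significant bit. -/
def bits (N : ℕ) (k : ℤ) : Fin N → Bool :=
  fun i => decide (((if k < 0 then 2 ^ N + k else k) / 2 ^ (i : ℕ)) % 2 = 1)

/-- `P{γ(Z+β) ∈ [k,k+1)}` for standard Gaussian `Z`. -/
def cellMass (β γ : ℝ) (k : ℤ) : ℝ :=
  gaussQ ((k - γ * β) / γ) - gaussQ ((k + 1 - γ * β) / γ)

/-- Joint law of the noise bits `(Z_0, …, Z_{N-1})`: the Gaussian mass of all cells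
`[k, k+1)`, `-⌈γA⌉ ≤ k ≤ ⌈γ(A+2β)⌉ - 1`, whose label is `z`, normalized. -/
def noiseProb (N : ℕ) (A β γ : ℝ) (z : Fin N → Bool) : ℝ :=
  (∑ k ∈ Finset.Ico (-⌈γ * A⌉) ⌈γ * (A + 2 * β)⌉ with bits N k = z, cellMass β γ k) /
    (gaussQ ((-⌈γ * A⌉ - γ * β) / γ) - gaussQ ((⌈γ * (A + 2 * β)⌉ - γ * β) / γ))

/-- Extension of a bit vector by zeros. -/
def ext {N : ℕ} (x : Fin N → Bool) (i : ℕ) : Bool :=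
  if h : i < N then x ⟨i, h⟩ else false

/-- The carry-over bit of a binary addition, out of the two summand bits and the incoming carry. -/
def carryBit (x z w : Bool) : Bool := (x && z) ^^ (x && w) ^^ (z && w)

/-- The carry-over bits `W_i`. -/
def carry {N : ℕ} (x z : Fin N → Bool) : ℕ → Bool
  | 0 => false
  | i + 1 => carryBit (ext x i) (ext z i) (carry x z i)

/-- The intensity level `∑ x_i 2^i` of an input vector. -/
def level {N : ℕ} (x : Fin N → Bool) : ℝ := ∑ i : Fin N, if x i then (2 : ℝ) ^ (i : ℕ) else 0

/-- What the channel draws in one use: the noise vector and whether the output is erased. -/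
abbrev State (N : ℕ) := (Fin N → Bool) × Bool

/-- Probability of the state `(z, erased?)` given the input vector `x`. The noise is independent
of the input, and the erasure occurs with conditional probability `e x`. -/
def stateProb {N : ℕ} (A β γ : ℝ) (e : (Fin N → Bool) → ℝ) (x : Fin N → Bool) (s : State N) : ℝ :=
  noiseProb N A β γ s.1 * (if s.2 then e x else 1 - e x)

/-- The channel output: `Y_i = X_i + Z_i + W_i mod 2` on every bit-pipe if the channel use is not
erased, and the erasure symbol `none` on every bit-pipe otherwise. -/
def output {N : ℕ} (x : Fin N → Bool) (s : State N) : Fin N → Option Bool :=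
  fun i => if s.2 then none else some (x i ^^ s.1 i ^^ carry x s.1 i)

/-- The outputs with `Y_i = 0` for `i > N - 1`. -/
def outputExt {N : ℕ} (y : Fin N → Option Bool) (i : ℕ) : Option Bool :=
  if h : i < N then y ⟨i, h⟩ else some false

/-! ### The rate expression -/

/-- Law of an input vector with independent `Bern(p_i)` bits. -/
def inputProb {N : ℕ} (p : Fin N → ℝ) (x : Fin N → Bool) : ℝ :=
  ∏ i, if x i then p i else 1 - p i

/-- Joint law of the input vector and the channel state. -/
def jointLaw {N : ℕ} (A β γ : ℝ) (e : (Fin N → Bool) → ℝ) (p : Fin N → ℝ) :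
    (Fin N → Bool) × State N → ℝ :=
  fun ω => inputProb p ω.1 * stateProb A β γ e ω.1 ω.2

/-- The tuple `(Ȳ_i, Y_{i+1}, …, Y_{i+q})`, where `Ȳ_i = Y_i + W_i mod 2` if `Y_i` is not erased,
and `Ȳ_i` is the erasure symbol otherwise. -/
def cdObs {N : ℕ} (q : ℕ) (i : Fin N) (ω : (Fin N → Bool) × State N) :
    Fin (q + 1) → Option Bool :=
  Fin.cons ((output ω.1 ω.2 i).map fun b => b ^^ carry ω.1 ω.2.1 i)
    fun j : Fin q => outputExt (output ω.1 ω.2) (i + (j + 1))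

/-- `I(X_i; Ȳ_i, Y_{i+1}, …, Y_{i+q} | Ȳ_i ≠ ξ)`: mutual information under the law conditioned on
the event that `Ȳ_i` is not erased. -/
def cdInfo {N : ℕ} (A β γ : ℝ) (e : (Fin N → Bool) → ℝ) (q : ℕ) (p : Fin N → ℝ)
    (i : Fin N) : ℝ :=
  mutualInfo (condLaw (jointLaw A β γ e p) fun ω => cdObs q i ω 0 ≠ none)
    (fun ω => ω.1 i) (cdObs q i)

/-- The parameters `p` allowed by the peak and average constraints; the bit-pipes with `p_i > 0`
are `on`. -/
def Feasible {N : ℕ} (A E γ : ℝ) (p : Fin N → ℝ) : Prop :=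
  (∀ i, 0 ≤ p i ∧ p i ≤ 1) ∧
  ∑ i with 0 < p i, (2 : ℝ) ^ (i : ℕ) ≤ γ * A ∧
  ∑ i with 0 < p i, p i * (2 : ℝ) ^ (i : ℕ) ≤ γ * E

/-! ### Carry-over-assisted decoding -/

/-- A block code of length `n` for the scheme: message set `Fin (M i)`, a separate encoder and a
decoder for each bit-pipe. The decoder of bit-pipe `i` sees the `n` tuples
`(Ȳ_i(t), Y_{i+1}(t), …, Y_{i+q}(t))` and nothing else. -/
structure CDCode (N q n : ℕ) where
  M : Fin N → ℕ
  M_pos : ∀ i, 0 < M i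
  enc : ∀ i, Fin (M i) → Fin n → Bool
  dec : ∀ i, (Fin n → Fin (q + 1) → Option Bool) → Fin (M i)

/-- The carry-over bits as the receiver computes them from an output vector `y` and decoded input
bits `x`: it recovers the noise bit `Y_i + X_i + W_i mod 2` and carries on. The bit with index `i`
depends on `x` and `y` at indices below `i` only. (Used at non-erased times only.) -/
def rxCarry {N : ℕ} (x : Fin N → Bool) (y : Fin N → Option Bool) : ℕ → Bool
  | 0 => false
  | i + 1 => carryBit (ext x i)
      (((outputExt y i).getD false ^^ rxCarry x y i) ^^ ext x i) (rxCarry x y i)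

/-- The input of the decoder of bit-pipe `i`, at one time, computed from the output vector `y` and
the decoded bits `x` of the lower bit-pipes. -/
def rxObs {N : ℕ} (q : ℕ) (i : Fin N) (x : Fin N → Bool) (y : Fin N → Option Bool) :
    Fin (q + 1) → Option Bool :=
  Fin.cons ((y i).map fun b => b ^^ rxCarry x y i)
    fun j : Fin q => outputExt y (i + (j + 1))

namespace CDCode

variable {N q n : ℕ}

/-- A tuple of messages, one for each bit-pipe. -/
abbrev Msg (c : CDCode N q n) := ∀ i, Fin (c.M i)

/-- The input vector sent at time `t` for the message tuple `m`. -/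
def word (c : CDCode N q n) (m : c.Msg) (t : Fin n) : Fin N → Bool := fun i => c.enc i (m i) t

/-- The estimates after the bit-pipes `0, …, k-1` have been decoded, in this order, each one with
the carry-over bits computed from the messages decoded before (the later entries are
placeholders). -/
def decodeUpTo (c : CDCode N q n) (y : Fin n → Fin N → Option Bool) : ℕ → c.Msg
  | 0 => fun i => ⟨0, c.M_pos i⟩
  | k + 1 =>
    if h : k < N then
      Function.update (decodeUpTo c y k) ⟨k, h⟩
        (c.dec ⟨k, h⟩ fun t => rxObs q ⟨k, h⟩ (c.word (decodeUpTo c y k) t) (y t))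
    else decodeUpTo c y k

/-- The decoded message tuple. -/
def decode (c : CDCode N q n) (y : Fin n → Fin N → Option Bool) : c.Msg := c.decodeUpTo y N

/-- Probability that some message is decoded wrongly, for uniformly distributed messages over `n`
uses of the memoryless channel. -/
def errorProb (c : CDCode N q n) (A β γ : ℝ) (e : (Fin N → Bool) → ℝ) : ℝ :=
  (∑ m : c.Msg, ∑ s : Fin n → State N,
    if c.decode (fun t => output (c.word m t) (s t)) = m then 0
    else ∏ t, stateProb A β γ e (c.word m t) (s t)) / ∏ i, (c.M i : ℝ)

/-- The input constraints. Only bit-pipes from a set `V` with `∑_{i ∈ V} 2^i ≤ γA` are used, which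
gives the peak constraint at every time, and every transmitted block meets the average
constraint. -/
def Admissible (c : CDCode N q n) (A E γ : ℝ) : Prop :=
  (∃ V : Finset (Fin N), ∑ i ∈ V, (2 : ℝ) ^ (i : ℕ) ≤ γ * A ∧
    ∀ i ∉ V, c.M i = 1 ∧ ∀ m t, c.enc i m t = false) ∧
  ∀ m : c.Msg, ∑ t, level (c.word m t) ≤ n * (γ * E)

end CDCode

/-- The scheme achieves the total rate `r` (in bits per channel use): for every `δ > 0` and all
large block lengths there is a code of total rate at least `r - δ` with error probability at most
`δ`. -/
def CDAchieves {N : ℕ} (A E β γ : ℝ) (e : (Fin N → Bool) → ℝ) (q : ℕ) (r : ℝ) : Prop :=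
  ∀ δ : ℝ, 0 < δ → ∀ᶠ n : ℕ in Filter.atTop, ∃ c : CDCode N q n,
    c.Admissible A E γ ∧ n * (r - δ) ≤ ∑ i, Real.logb 2 (c.M i) ∧ c.errorProb A β γ e ≤ δ

end

end VBC

/-!
As long as the messages of the lower bit-pipes are decoded correctly, the receiver's carries agree
with the true ones, so the decoder of bit-pipe `i` sees exactly `(Ȳ_i, Y_{i+1}, …, Y_{i+q})`. By the
union bound it is enough to bound the error of each bit-pipe when it is given the true carries.

Draw the letters of the codewords of bit-pipe `i` independently with law `Bern(p'_i)`, where `p'_i`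
is slightly smaller than `p_i`; with high probability a codeword then has at most `n p_i` ones, and
heavier codewords are replaced by zero. Decode by comparing a product of likelihood ratios
`P(x, o | Ȳ_i ≠ ξ) / (P(x) P(o | Ȳ_i ≠ ξ))`, with factor `1` at the erased times, to the threshold
`2 ^ (n θ)`. A wrong codeword is independent of the output, and its score has mean at most `1`, so
it passes with probability at most `2 ^ (-n θ)`. The logarithm of the score of the sent codeword
grows at least at the rate `P(Ȳ_i ≠ ξ) I ≥ (1 - ε) I`, where `ε` bounds the erasure probabilities,
so every rate below `(1 - ε) I` is achieved.

The maximum exists because the feasible set is compact (the peak constraint is closed since the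
weight of the bit-pipes in use is lower semicontinuous in `p`) and because `P(Ȳ_i ≠ ξ) ≥ 1 - ε > 0`
makes the conditional mutual information continuous.
-/

namespace VBC

open Finset Filter Topology

/-! ### Laws on finite types -/

section Mass

variable {Ω α κ : Type*} [Fintype Ω] {μ : Ω → ℝ}

/-- Mass of the event `S` under the weights `μ`; unlike `∑ ω with ω ∈ S, μ ω`, it needs no
decidability. -/
noncomputable def mass (μ : Ω → ℝ) (S : Set Ω) : ℝ := ∑ ω, S.indicator μ ω

theorem mass_eq_sum_ite (μ : Ω → ℝ) (S : Set Ω) [DecidablePred (· ∈ S)] :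
    mass μ S = ∑ ω, if ω ∈ S then μ ω else 0 :=
  sum_congr rfl fun _ _ => Set.indicator_apply _ _ _

theorem mass_le_of_imp (hμ : ∀ ω, 0 ≤ μ ω) {S T : Set Ω}
    (h : ∀ ω, 0 < μ ω → ω ∈ S → ω ∈ T) : mass μ S ≤ mass μ T := by
  classical
  simp only [mass_eq_sum_ite]
  refine sum_le_sum fun ω _ => ?_
  have := hμ ω
  grind

theorem mass_mono (hμ : ∀ ω, 0 ≤ μ ω) {S T : Set Ω} (h : S ⊆ T) : mass μ S ≤ mass μ T :=
  mass_le_of_imp hμ fun _ _ hω => h hω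

theorem mass_nonneg (hμ : ∀ ω, 0 ≤ μ ω) (S : Set Ω) : 0 ≤ mass μ S :=
  sum_nonneg fun _ _ => Set.indicator_nonneg (fun ω _ => hμ ω) _

theorem mass_univ (hμ : μ ∈ stdSimplex ℝ Ω) : mass μ Set.univ = 1 := by
  simpa [mass] using hμ.2

theorem mass_le_one (hμ : μ ∈ stdSimplex ℝ Ω) (S : Set Ω) : mass μ S ≤ 1 :=
  (mass_mono hμ.1 S.subset_univ).trans_eq (mass_univ hμ)

theorem mass_union_le (hμ : ∀ ω, 0 ≤ μ ω) (S T : Set Ω) :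
    mass μ (S ∪ T) ≤ mass μ S + mass μ T := by
  classical
  simp only [mass_eq_sum_ite, ← sum_add_distrib]
  refine sum_le_sum fun ω _ => ?_
  have := hμ ω
  grind

theorem mass_iUnion_le [Fintype κ] (hμ : ∀ ω, 0 ≤ μ ω) (S : κ → Set Ω) :
    mass μ (⋃ k, S k) ≤ ∑ k, mass μ (S k) := by
  simp only [mass]
  rw [sum_comm]
  have h0 : ∀ ω k, 0 ≤ (S k).indicator μ ω :=
    fun ω k => Set.indicator_nonneg (fun ω _ => hμ ω) ω
  refine sum_le_sum fun ω _ => Set.indicator_apply_le' (fun hω => ?_) fun _ =>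
    sum_nonneg fun k _ => h0 ω k
  obtain ⟨k, hk⟩ := Set.mem_iUnion.1 hω
  rw [← Set.indicator_of_mem hk μ]
  exact single_le_sum (fun k _ => h0 ω k) (mem_univ k)

theorem mass_le_inv_mul_sum (hμ : ∀ ω, 0 ≤ μ ω) {g : Ω → ℝ} (hg : ∀ ω, 0 ≤ g ω) {τ : ℝ}
    (hτ : 0 < τ) : mass μ {ω | τ ≤ g ω} ≤ τ⁻¹ * ∑ ω, μ ω * g ω := by
  rw [mass, mul_sum]
  refine sum_le_sum fun ω _ => Set.indicator_apply_le' (fun hω : τ ≤ g ω => ?_) fun _ =>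
    mul_nonneg (inv_nonneg.2 hτ.le) (mul_nonneg (hμ ω) (hg ω))
  calc μ ω = τ⁻¹ * (μ ω * τ) := by field_simp
    _ ≤ τ⁻¹ * (μ ω * g ω) := by
      gcongr
      exact hμ ω

end Mass

section Prob

variable {Ω α β : Type*} [Fintype Ω] [DecidableEq α] [DecidableEq β] {μ : Ω → ℝ}

theorem prob_nonneg (hμ : ∀ ω, 0 ≤ μ ω) (f : Ω → α) (a : α) : 0 ≤ prob μ f a :=
  sum_nonneg fun ω _ => hμ ω

theorem prob_apply_pos (hμ : ∀ ω, 0 ≤ μ ω) (f : Ω → α) {ω : Ω} (hω : 0 < μ ω) :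
    0 < prob μ f (f ω) :=
  hω.trans_le (single_le_sum (f := μ) (fun ω _ => hμ ω) (by simp))

theorem exists_pos_of_prob_pos {f : Ω → α} {a : α} (h : 0 < prob μ f a) :
    ∃ ω, f ω = a ∧ 0 < μ ω := by
  by_contra! hc
  exact h.not_ge (sum_nonpos fun ω hω => hc ω (by simpa using hω))

theorem prob_equiv (μ : Ω → ℝ) (f : Ω ≃ α) (a : α) : prob μ f a = μ (f.symm a) := by
  obtain ⟨ω, rfl⟩ := f.surjective a
  rw [prob, sum_filter, Fintype.sum_eq_single ω fun x hx => if_neg (f.injective.ne hx), if_pos rfl,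
    f.symm_apply_apply]

variable [Fintype α]

theorem sum_prob_mul (μ : Ω → ℝ) (f : Ω → α) (F : α → ℝ) :
    ∑ a, prob μ f a * F a = ∑ ω, μ ω * F (f ω) := by
  rw [← sum_fiberwise univ f]
  refine sum_congr rfl fun a _ => ?_
  rw [prob, sum_mul]
  exact sum_congr rfl fun ω hω => by rw [(mem_filter.1 hω).2]

theorem sum_prob (μ : Ω → ℝ) (f : Ω → α) : ∑ a, prob μ f a = ∑ ω, μ ω := by
  simpa using sum_prob_mul μ f fun _ => 1

theorem prob_mem_stdSimplex (hμ : μ ∈ stdSimplex ℝ Ω) (f : Ω → α) :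
    prob μ f ∈ stdSimplex ℝ α :=
  ⟨prob_nonneg hμ.1 f, (sum_prob μ f).trans hμ.2⟩

theorem prob_prob (μ : Ω → ℝ) (f : Ω → α) (g : α → β) :
    prob (prob μ f) g = prob μ (g ∘ f) := by
  ext b
  simpa [prob, sum_filter] using sum_prob_mul μ f fun a => if g a = b then 1 else 0

theorem mass_prob (μ : Ω → ℝ) (f : Ω → α) (T : Set α) : mass (prob μ f) T = mass μ (f ⁻¹' T) := by
  classical
  simpa [mass_eq_sum_ite] using sum_prob_mul μ f fun a => if a ∈ T then 1 else 0

theorem sum_prob_pair_left (μ : Ω → ℝ) (f : Ω → α) (g : Ω → β) (b : β) :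
    ∑ a, prob μ (fun ω => (f ω, g ω)) (a, b) = prob μ g b := by
  simp only [prob, Prod.mk.injEq, and_comm (a := f _ = _), ← filter_filter]
  exact sum_fiberwise _ f μ

end Prob

section CompProd

variable {α β : Type*} [Fintype α] [Fintype β] {P : α → ℝ} {K : α → β → ℝ}

/-- Joint law of a random variable of law `P` and of the output of the kernel `K` at it. -/
def compProd (P : α → ℝ) (K : α → β → ℝ) : α × β → ℝ := fun ω => P ω.1 * K ω.1 ω.2

theorem compProd_mem_stdSimplex (hP : P ∈ stdSimplex ℝ α) (hK : ∀ a, K a ∈ stdSimplex ℝ β) :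
    compProd P K ∈ stdSimplex ℝ (α × β) := by
  refine ⟨fun ω => mul_nonneg (hP.1 _) ((hK _).1 _), ?_⟩
  simp [compProd, Fintype.sum_prod_type, ← mul_sum, (hK _).2, hP.2]

theorem mass_compProd (P : α → ℝ) (K : α → β → ℝ) (S : Set (α × β)) :
    mass (compProd P K) S = ∑ a, P a * mass (K a) {b | (a, b) ∈ S} := by
  classical
  simp only [mass_eq_sum_ite, Fintype.sum_prod_type, mul_sum, mul_ite, mul_zero]
  rfl

theorem prob_compProd_fst [DecidableEq α] (P : α → ℝ) (hK : ∀ a, K a ∈ stdSimplex ℝ β) :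
    prob (compProd P K) Prod.fst = P := by
  ext a
  simp [prob, sum_filter, compProd, Fintype.sum_prod_type, ← mul_sum, (hK _).2]

theorem prob_compProd_map {γ : Type*} [DecidableEq γ] [DecidableEq β] (P : α → ℝ)
    (f : α → γ) (K : γ → β → ℝ) :
    prob (compProd P fun a => K (f a)) (Prod.map f id) = compProd (prob P f) K := by
  ext ⟨c, b⟩
  simp only [prob, sum_filter, compProd, Fintype.sum_prod_type, Prod.map, id, Prod.mk.injEq,
    ite_and, sum_mul, ite_mul, zero_mul]
  refine sum_congr rfl fun a _ => ?_
  split_ifs with h <;> simp [h]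

end CompProd

section PiLaw

variable {ι κ α : Type*} [Fintype ι] [Fintype κ]

/-- Law of independent random variables, the `i`-th one of law `w i`. -/
def piLaw (w : ι → α → ℝ) : (ι → α) → ℝ := fun x => ∏ i, w i (x i)

/-- Law of `n` independent random variables of law `μ`. -/
abbrev iidLaw (n : ℕ) (μ : α → ℝ) : (Fin n → α) → ℝ := piLaw fun _ => μ

theorem pos_of_piLaw_pos {w : ι → α → ℝ} (hw : ∀ i a, 0 ≤ w i a) {x : ι → α}
    (h : 0 < piLaw w x) (i : ι) : 0 < w i (x i) :=
  (hw i _).lt_of_ne fun h0 => h.ne' (prod_eq_zero (mem_univ i) h0.symm)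

theorem piLaw_update_mul [DecidableEq ι] (w : ι → α → ℝ) (x : ι → α) (i : ι) (a : α) :
    piLaw w (Function.update x i a) * w i (x i) = piLaw w x * w i a := by
  have h : ∏ j ∈ univ.erase i, w j (Function.update x i a j) = ∏ j ∈ univ.erase i, w j (x j) :=
    prod_congr rfl fun j hj => by rw [Function.update_of_ne (ne_of_mem_erase hj)]
  simp only [piLaw]
  rw [← mul_prod_erase univ _ (mem_univ i), ← mul_prod_erase univ (fun j => w j (x j))
    (mem_univ i), h, Function.update_self]
  ring

variable [Fintype α]

theorem sum_prod_eq_prod_sum [DecidableEq ι] (w : ι → α → ℝ) :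
    ∑ x : ι → α, ∏ i, w i (x i) = ∏ i, ∑ a, w i a :=
  (Fintype.prod_sum w).symm

theorem piLaw_mem_stdSimplex [DecidableEq ι] {w : ι → α → ℝ} (hw : ∀ i, w i ∈ stdSimplex ℝ α) :
    piLaw w ∈ stdSimplex ℝ (ι → α) := by
  refine ⟨fun x => prod_nonneg fun i _ => (hw i).1 _, ?_⟩
  exact (sum_prod_eq_prod_sum w).trans (prod_eq_one fun i _ => (hw i).2)

theorem prob_piLaw_comp_injective [DecidableEq ι] [DecidableEq (κ → α)] {w : ι → α → ℝ}
    (hw : ∀ i, w i ∈ stdSimplex ℝ α) {σ : κ → ι} (hσ : Function.Injective σ) :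
    prob (piLaw w) (fun x => x ∘ σ) = piLaw (w ∘ σ) := by
  classical
  ext y
  let v : ι → α → ℝ := fun i a => if ∀ k, σ k = i → a = y k then w i a else 0
  have hv : ∀ x : ι → α, (if x ∘ σ = y then piLaw w x else 0) = ∏ i, v i (x i) := by
    intro x
    simp only [v, prod_ite_zero, piLaw]
    congr 1
    simp only [funext_iff, mem_univ, true_imp_iff, Function.comp_apply, eq_iff_iff]
    exact ⟨fun h i k hk => hk ▸ h k, fun h k => h (σ k) k rfl⟩
  rw [prob, sum_filter, sum_congr rfl fun x _ => hv x, sum_prod_eq_prod_sum]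
  refine (Fintype.prod_of_injective σ hσ _ _ (fun i hi => ?_) fun k => ?_).symm
  · have : ∀ k, σ k ≠ i := fun k hk => hi ⟨k, hk⟩
    simp [v, this, (hw i).2]
  · simp [v, hσ.eq_iff]

theorem prob_piLaw_eval [DecidableEq ι] [DecidableEq α] {w : ι → α → ℝ}
    (hw : ∀ i, w i ∈ stdSimplex ℝ α) (i : ι) : prob (piLaw w) (fun x => x i) = w i := by
  ext a
  have h := congrFun (prob_piLaw_comp_injective hw (σ := fun _ : Unit => i)
    (fun _ _ _ => rfl)) fun _ => a
  simpa [prob, piLaw, funext_iff] using h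

theorem sum_piLaw_update [DecidableEq ι] (w : ι → α → ℝ) (i : ι) (hi : ∑ a, w i a = 1)
    (F : (ι → α) → ℝ) :
    ∑ x, piLaw w x * ∑ a, w i a * F (Function.update x i a) = ∑ x, piLaw w x * F x := by
  -- exchanging the `i`-th coordinate of `x` with the fresh sample `a` preserves the weights
  have hinv : Function.Involutive fun c : (ι → α) × α => (Function.update c.1 i c.2, c.1 i) :=
    fun c => by simp
  calc ∑ x, piLaw w x * ∑ a, w i a * F (Function.update x i a)
      = ∑ c : (ι → α) × α, piLaw w (Function.update c.1 i c.2) * w i (c.1 i) *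
          F (Function.update c.1 i c.2) := by
        simp only [piLaw_update_mul, Fintype.sum_prod_type, mul_sum, mul_assoc]
    _ = ∑ c : (ι → α) × α, piLaw w c.1 * w i c.2 * F c.1 :=
        Equiv.sum_comp (hinv.toPerm _) fun c : (ι → α) × α => piLaw w c.1 * w i c.2 * F c.1
    _ = ∑ x, piLaw w x * F x := by
        simp only [Fintype.sum_prod_type, ← sum_mul, ← mul_sum, hi, mul_one]

end PiLaw

section WeakLaw

variable {Ω : Type*} [Fintype Ω] {μ : Ω → ℝ}

theorem exists_pos_sum_mul_exp_lt_one (hμ : ∑ ω, μ ω = 1) {g : Ω → ℝ}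
    (hg : ∑ ω, μ ω * g ω < 0) : ∃ l > 0, ∑ ω, μ ω * Real.exp (l * g ω) < 1 := by
  set φ : ℝ → ℝ := fun l => ∑ ω, μ ω * Real.exp (l * g ω) with hφ
  have hd : HasDerivAt φ (∑ ω, μ ω * g ω) 0 := by
    refine HasDerivAt.fun_sum fun ω _ => HasDerivAt.const_mul _ ?_
    simpa using ((hasDerivAt_id (0 : ℝ)).mul_const (g ω)).exp
  have h0 : φ 0 = 1 := by simp [hφ, hμ]
  have hs := hd.tendsto_slope_zero_right.eventually (gt_mem_nhds hg)
  obtain ⟨l, hl, hlpos : 0 < l⟩ := (hs.and self_mem_nhdsWithin).exists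
  simp only [zero_add, h0, smul_eq_mul] at hl
  exact ⟨l, hlpos, sub_neg.1 (neg_of_mul_neg_right hl (inv_nonneg.2 hlpos.le))⟩

theorem mass_iidLaw_sum_nonneg_le (hμ : ∀ ω, 0 ≤ μ ω) (g : Ω → ℝ) {l : ℝ} (hl : 0 < l) (n : ℕ) :
    mass (iidLaw n μ) {x | 0 ≤ ∑ t, g (x t)} ≤ (∑ ω, μ ω * Real.exp (l * g ω)) ^ n := by
  have hx : ∀ x : Fin n → Ω, 0 ≤ iidLaw n μ x := fun x => prod_nonneg fun t _ => hμ _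
  calc mass (iidLaw n μ) {x | 0 ≤ ∑ t, g (x t)}
      ≤ mass (iidLaw n μ) {x | 1 ≤ Real.exp (l * ∑ t, g (x t))} :=
        mass_mono hx fun x (h : 0 ≤ ∑ t, g (x t)) => Real.one_le_exp (mul_nonneg hl.le h)
    _ ≤ 1⁻¹ * ∑ x, iidLaw n μ x * Real.exp (l * ∑ t, g (x t)) :=
        mass_le_inv_mul_sum hx (fun x => (Real.exp_pos _).le) one_pos
    _ = ∑ x : Fin n → Ω, ∏ t, μ (x t) * Real.exp (l * g (x t)) := by
        simp only [inv_one, one_mul, piLaw, mul_sum, Real.exp_sum, prod_mul_distrib]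
    _ = _ := by rw [sum_prod_eq_prod_sum fun (_ : Fin n) ω => μ ω * Real.exp (l * g ω)]; simp

theorem tendsto_mass_iidLaw_sum_le (hμ : μ ∈ stdSimplex ℝ Ω) (f : Ω → ℝ) {m : ℝ}
    (hm : m < ∑ ω, μ ω * f ω) :
    Tendsto (fun n : ℕ => mass (iidLaw n μ) {x | ∑ t, f (x t) ≤ n * m}) atTop (𝓝 0) := by
  have hneg : ∑ ω, μ ω * (m - f ω) < 0 := by
    simpa [mul_sub, ← sum_mul, hμ.2] using hm
  obtain ⟨l, hl, hlt⟩ := exists_pos_sum_mul_exp_lt_one hμ.2 hneg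
  have h0 : 0 ≤ ∑ ω, μ ω * Real.exp (l * (m - f ω)) :=
    sum_nonneg fun ω _ => mul_nonneg (hμ.1 ω) (Real.exp_pos _).le
  refine squeeze_zero (fun n => mass_nonneg (piLaw_mem_stdSimplex fun _ => hμ).1 _) (fun n => ?_)
    (tendsto_pow_atTop_nhds_zero_of_lt_one h0 hlt)
  simpa using mass_iidLaw_sum_nonneg_le hμ.1 (fun ω => m - f ω) hl n

theorem tendsto_mass_iidLaw_lt_sum (hμ : μ ∈ stdSimplex ℝ Ω) (f : Ω → ℝ) {m : ℝ}
    (hm : ∑ ω, μ ω * f ω < m) :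
    Tendsto (fun n : ℕ => mass (iidLaw n μ) {x | n * m < ∑ t, f (x t)}) atTop (𝓝 0) := by
  refine squeeze_zero (fun n => mass_nonneg (piLaw_mem_stdSimplex fun _ => hμ).1 _) (fun n => ?_)
    (tendsto_mass_iidLaw_sum_le hμ (fun ω => -f ω) (m := -m) (by simpa using hm))
  refine mass_mono (piLaw_mem_stdSimplex fun _ => hμ).1 fun x (hx : n * m < _) => ?_
  simpa using hx.le

end WeakLaw

/-! ### Mutual information -/

section MutualInfo

theorem sum_mul_logb_div_nonneg {ι : Type*} [Fintype ι] {P R : ι → ℝ} (hP : ∀ a, 0 ≤ P a)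
    (hR : ∀ a, 0 ≤ R a) (hPR : ∀ a, 0 < P a → 0 < R a) (hsum : ∑ a, R a ≤ ∑ a, P a) :
    0 ≤ ∑ a, P a * Real.logb 2 (P a / R a) := by
  have hterm : ∀ a, R a * InformationTheory.klFun (P a / R a) =
      P a * Real.log (P a / R a) - (P a - R a) := by
    intro a
    rcases (hR a).eq_or_lt with h | h
    · have : P a = 0 := le_antisymm (not_lt.1 fun hp => (hPR a hp).ne h) (hP a)
      simp [← h, this]
    · rw [InformationTheory.klFun_apply]
      field_simp
      ring
  have hkl : 0 ≤ ∑ a, (P a * Real.log (P a / R a) - (P a - R a)) := sum_nonneg fun a _ =>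
    (hterm a).symm ▸ mul_nonneg (hR a)
      (InformationTheory.klFun_nonneg (div_nonneg (hP a) (hR a)))
  simp only [sum_sub_distrib] at hkl
  simp only [Real.logb, ← mul_div_assoc, ← sum_div]
  exact div_nonneg (by linarith) (Real.log_nonneg one_le_two)

variable {Ω α β : Type*} [Fintype Ω] [Fintype α] [Fintype β] [DecidableEq α] [DecidableEq β]
  {μ : Ω → ℝ}

theorem mutualInfo_eq_sum (μ : Ω → ℝ) (f : Ω → α) (g : Ω → β) :
    mutualInfo μ f g = ∑ ω, μ ω * Real.logb 2 (prob μ (fun ω => (f ω, g ω)) (f ω, g ω) /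
      (prob μ f (f ω) * prob μ g (g ω))) := by
  rw [mutualInfo, ← Fintype.sum_prod_type', ← sum_prob_mul μ (fun ω => (f ω, g ω))
    fun c => Real.logb 2 (prob μ (fun ω => (f ω, g ω)) c / (prob μ f c.1 * prob μ g c.2))]

theorem mutualInfo_nonneg (hμ : μ ∈ stdSimplex ℝ Ω) (f : Ω → α) (g : Ω → β) :
    0 ≤ mutualInfo μ f g := by
  rw [mutualInfo, ← Fintype.sum_prod_type']
  refine sum_mul_logb_div_nonneg (P := fun c : α × β => prob μ (fun ω => (f ω, g ω)) c)
    (R := fun c => prob μ f c.1 * prob μ g c.2) (fun c => prob_nonneg hμ.1 _ _)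
    (fun c => mul_nonneg (prob_nonneg hμ.1 _ _) (prob_nonneg hμ.1 _ _)) (fun c hc => ?_) ?_
  · obtain ⟨ω, rfl, hω⟩ := exists_pos_of_prob_pos hc
    exact mul_pos (prob_apply_pos hμ.1 f hω) (prob_apply_pos hμ.1 g hω)
  · simp [Fintype.sum_prod_type, ← mul_sum, sum_prob, hμ.2]

theorem mutualInfo_le_sum_mul_logb (hμ : μ ∈ stdSimplex ℝ Ω) (f : Ω → α) (g : Ω → β) {P : α → ℝ}
    (hP : P ∈ stdSimplex ℝ α) (hpos : ∀ ω, 0 < μ ω → 0 < P (f ω)) :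
    mutualInfo μ f g ≤ ∑ ω, μ ω * Real.logb 2 (prob μ (fun ω => (f ω, g ω)) (f ω, g ω) /
      (P (f ω) * prob μ g (g ω))) := by
  have hkl : 0 ≤ ∑ ω, μ ω * Real.logb 2 (prob μ f (f ω) / P (f ω)) := by
    rw [← sum_prob_mul μ f fun a => Real.logb 2 (prob μ f a / P a)]
    refine sum_mul_logb_div_nonneg (prob_nonneg hμ.1 f) hP.1 (fun a ha => ?_)
      (by rw [sum_prob, hμ.2, hP.2])
    obtain ⟨ω, rfl, hω⟩ := exists_pos_of_prob_pos ha
    exact hpos ω hω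
  rw [mutualInfo_eq_sum]
  refine (le_add_of_nonneg_right hkl).trans_eq ?_
  rw [← sum_add_distrib]
  refine sum_congr rfl fun ω _ => ?_
  rcases (hμ.1 ω).eq_or_lt with h | h
  · simp [← h]
  · have hf := prob_apply_pos hμ.1 f h
    have hg := prob_apply_pos hμ.1 g h
    have hfg := prob_apply_pos hμ.1 (fun ω => (f ω, g ω)) h
    have hPω := hpos ω h
    rw [← mul_add, ← Real.logb_mul (by positivity) (by positivity)]
    congr 2
    field_simp

theorem mutualInfo_eq_zero_of_const (hμ : μ ∈ stdSimplex ℝ Ω) {f : Ω → α} (g : Ω → β) {a : α}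
    (hf : ∀ ω, 0 < μ ω → f ω = a) : mutualInfo μ f g = 0 := by
  rw [mutualInfo_eq_sum]
  refine sum_eq_zero fun ω _ => ?_
  rcases (hμ.1 ω).eq_or_lt with h | h
  · simp [← h]
  have hfω : ∀ ω', μ ω' ≠ 0 → f ω' = f ω := fun ω' h' =>
    (hf ω' ((hμ.1 ω').lt_of_ne' h')).trans (hf ω h).symm
  have hfg : prob μ (fun ω => (f ω, g ω)) (f ω, g ω) = prob μ g (g ω) := by
    simp only [prob, sum_filter, Prod.mk.injEq]
    refine sum_congr rfl fun ω' _ => ?_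
    by_cases h' : μ ω' = 0
    · simp [h']
    · simp [hfω ω' h']
  have hf1 : prob μ f (f ω) = 1 := by
    rw [prob, sum_filter_of_ne fun ω' _ => hfω ω', hμ.2]
  rw [hfg, hf1, one_mul, div_self (prob_apply_pos hμ.1 g h).ne', Real.logb_one, mul_zero]

theorem sum_negMulLog_prob (μ : Ω → ℝ) (f : Ω → α) :
    ∑ a, Real.negMulLog (prob μ f a) = -∑ ω, μ ω * Real.log (prob μ f (f ω)) := by
  rw [← sum_prob_mul μ f fun a => Real.log (prob μ f a), ← sum_neg_distrib]
  exact sum_congr rfl fun a _ => by rw [Real.negMulLog, neg_mul]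

theorem mutualInfo_eq_entropy (hμ : ∀ ω, 0 ≤ μ ω) (f : Ω → α) (g : Ω → β) :
    mutualInfo μ f g = (∑ a, Real.negMulLog (prob μ f a) + ∑ b, Real.negMulLog (prob μ g b) -
      ∑ c, Real.negMulLog (prob μ (fun ω => (f ω, g ω)) c)) / Real.log 2 := by
  simp only [sum_negMulLog_prob]
  rw [mutualInfo_eq_sum, sub_neg_eq_add, ← neg_add, neg_add_eq_sub, ← sum_add_distrib,
    ← sum_sub_distrib, sum_div]
  refine sum_congr rfl fun ω _ => ?_
  rcases (hμ ω).eq_or_lt with h | h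
  · simp [← h]
  · have hf := prob_apply_pos hμ f h
    have hg := prob_apply_pos hμ g h
    have hfg := prob_apply_pos hμ (fun ω => (f ω, g ω)) h
    rw [Real.logb, Real.log_div hfg.ne' (mul_pos hf hg).ne', Real.log_mul hf.ne' hg.ne']
    ring

theorem continuousOn_mutualInfo (f : Ω → α) (g : Ω → β) :
    ContinuousOn (fun μ : Ω → ℝ => mutualInfo μ f g) {μ | ∀ ω, 0 ≤ μ ω} := by
  refine ContinuousOn.congr (Continuous.continuousOn ?_) fun μ hμ => mutualInfo_eq_entropy hμ f g
  simp only [prob]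
  fun_prop

end MutualInfo

/-! ### A decoding score from the conditional law -/

section CondLaw

variable {Ω α β : Type*} [Fintype Ω] {μ : Ω → ℝ} {S : Ω → Prop} [DecidablePred S]

theorem condLaw_nonneg (hμ : ∀ ω, 0 ≤ μ ω) (S : Ω → Prop) [DecidablePred S] (ω : Ω) :
    0 ≤ condLaw μ S ω := by
  unfold condLaw
  split_ifs
  · exact div_nonneg (hμ ω) (sum_nonneg fun ω _ => hμ ω)
  · exact le_rfl

theorem condLaw_mem_stdSimplex (hμ : ∀ ω, 0 ≤ μ ω) (h : ∑ ω with S ω, μ ω ≠ 0) :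
    condLaw μ S ∈ stdSimplex ℝ Ω := by
  refine ⟨condLaw_nonneg hμ S, ?_⟩
  unfold condLaw
  rw [← sum_filter, ← sum_div, div_self h]

theorem mul_condLaw (h : ∑ ω with S ω, μ ω ≠ 0) (ω : Ω) :
    (∑ ω with S ω, μ ω) * condLaw μ S ω = if S ω then μ ω else 0 := by
  rw [condLaw, mul_ite, mul_zero, mul_div_cancel₀ _ h]

theorem pos_of_condLaw_pos (hμ : ∀ ω, 0 ≤ μ ω) {ω : Ω} (h : 0 < condLaw μ S ω) : 0 < μ ω := by
  refine (hμ ω).lt_of_ne fun h0 => ?_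
  simp [condLaw, ← h0] at h

variable [DecidableEq α] [DecidableEq β]

/-- The likelihood ratio used for decoding the value of `f` from the value of `g`: on the event `S`
it compares the law conditioned on `S` with the unconditioned law of `f`, and off `S` it carries no
information. -/
noncomputable def condScore (μ : Ω → ℝ) (f : Ω → α) (g : Ω → β) (S : β → Prop) [DecidablePred S]
    (a : α) (b : β) : ℝ :=
  if S b then prob (condLaw μ fun ω => S (g ω)) (fun ω => (f ω, g ω)) (a, b) /
    (prob μ f a * prob (condLaw μ fun ω => S (g ω)) g b) else 1

variable {f : Ω → α} {g : Ω → β} {S : β → Prop} [DecidablePred S]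

theorem condScore_nonneg (hμ : ∀ ω, 0 ≤ μ ω) (a : α) (b : β) : 0 ≤ condScore μ f g S a b := by
  have hν := condLaw_nonneg hμ fun ω => S (g ω)
  unfold condScore
  split_ifs
  · exact div_nonneg (prob_nonneg hν _ _) (mul_nonneg (prob_nonneg hμ _ _) (prob_nonneg hν _ _))
  · exact zero_le_one

theorem condScore_pos (hμ : ∀ ω, 0 ≤ μ ω) {ω : Ω} (hω : 0 < μ ω) :
    0 < condScore μ f g S (f ω) (g ω) := by
  have hν := condLaw_nonneg hμ fun ω => S (g ω)
  unfold condScore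
  split_ifs with h
  · have hS : 0 < ∑ ω with S (g ω), μ ω :=
      sum_pos' (fun ω _ => hμ ω) ⟨ω, by simpa using h, hω⟩
    have hpos : 0 < condLaw μ (fun ω => S (g ω)) ω := by
      rw [condLaw, if_pos h]
      exact div_pos hω hS
    exact div_pos (prob_apply_pos hν (fun ω => (f ω, g ω)) hpos)
      (mul_pos (prob_apply_pos hμ f hω) (prob_apply_pos hν g hpos))
  · exact zero_lt_one

variable [Fintype α]

theorem sum_prob_mul_condScore_le_one (hμ : μ ∈ stdSimplex ℝ Ω) (b : β) :
    ∑ a, prob μ f a * condScore μ f g S a b ≤ 1 := by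
  have hν := condLaw_nonneg hμ.1 fun ω => S (g ω)
  unfold condScore
  split_ifs
  · calc _ ≤ ∑ a, prob (condLaw μ fun ω => S (g ω)) (fun ω => (f ω, g ω)) (a, b) /
          prob (condLaw μ fun ω => S (g ω)) g b := by
          refine sum_le_sum fun a _ => ?_
          rcases (prob_nonneg hμ.1 f a).eq_or_lt with h | h
          · simp only [← h, zero_mul]
            exact div_nonneg (prob_nonneg hν _ _) (prob_nonneg hν _ _)
          · rw [← div_div, div_right_comm, mul_div_cancel₀ _ h.ne']
      _ ≤ 1 := by
          rw [← sum_div, sum_prob_pair_left]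
          exact div_self_le_one _
  · simp [sum_prob, hμ.2]

theorem mul_mutualInfo_condLaw_le [Fintype β] (hμ : μ ∈ stdSimplex ℝ Ω)
    (hS : ∑ ω with S (g ω), μ ω ≠ 0) :
    (∑ ω with S (g ω), μ ω) * mutualInfo (condLaw μ fun ω => S (g ω)) f g ≤
      ∑ ω, μ ω * Real.logb 2 (condScore μ f g S (f ω) (g ω)) := by
  have hle := mutualInfo_le_sum_mul_logb (condLaw_mem_stdSimplex hμ.1 hS) f g
    (prob_mem_stdSimplex hμ f) fun ω hω => prob_apply_pos hμ.1 f (pos_of_condLaw_pos hμ.1 hω)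
  refine (mul_le_mul_of_nonneg_left hle (sum_nonneg fun ω _ => hμ.1 ω)).trans_eq ?_
  simp only [mul_sum, ← mul_assoc, mul_condLaw hS]
  refine sum_congr rfl fun ω _ => ?_
  by_cases h : S (g ω) <;> simp [h, condScore]

end CondLaw

/-! ### Random coding with threshold decoding -/

section RandomCoding

theorem exists_le_of_sum_mul_le {Ω : Type*} [Fintype Ω] {μ : Ω → ℝ} (hμ : μ ∈ stdSimplex ℝ Ω)
    {F : Ω → ℝ} {b : ℝ} (h : ∑ ω, μ ω * F ω ≤ b) : ∃ ω, F ω ≤ b := by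
  by_contra! hF
  obtain ⟨ω, -, hω⟩ : ∃ ω ∈ univ, μ ω ≠ 0 := exists_ne_zero_of_sum_ne_zero (by simp [hμ.2])
  refine h.not_gt ?_
  calc b = ∑ ω, μ ω * b := by rw [← sum_mul, hμ.2, one_mul]
    _ < ∑ ω, μ ω * F ω := sum_lt_sum (fun ω _ => mul_le_mul_of_nonneg_left (hF ω).le (hμ.1 ω))
      ⟨ω, mem_univ ω, mul_lt_mul_of_pos_left (hF ω) ((hμ.1 ω).lt_of_ne' hω)⟩

theorem sum_mul_mass_comm {α β : Type*} [Fintype α] [Fintype β] (P : α → ℝ) (Q : β → ℝ)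
    (E : α → β → Prop) :
    ∑ a, P a * mass Q {b | E a b} = ∑ b, Q b * mass P {a | E a b} := by
  classical
  simp only [mass_eq_sum_ite, mul_sum, Set.mem_ofPred_eq, mul_ite, mul_zero]
  rw [sum_comm]
  simp only [mul_comm]

variable {ι α S Y : Type*} {κ : ι → Type*} {n : ℕ}

/-- A family of codebooks, one for each sender `i`, with a word of length `n` for every message in
`κ i`. -/
abbrev Codebook (κ : ι → Type*) (n : ℕ) (α : Type*) := (Σ i, κ i) → Fin n → α

/-- The channel inputs for the message tuple `m`. -/
def Codebook.word (C : Codebook κ n α) (m : ∀ i, κ i) (t : Fin n) : ι → α := fun i => C ⟨i, m i⟩ t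

/-- The score of a codeword `c` for an observed block `o`, from the scores of single letters. -/
def blockScore (L : α → Y → ℝ) (c : Fin n → α) (o : Fin n → Y) : ℝ := ∏ t, L (c t) (o t)

/-- The event that the message tuple `m` is decoded by thresholds: each sent codeword lies in `T i`
and is the only one of its codebook whose score reaches the threshold `τ i`. Decoder `i` sees the
observations `obs i` of the input and of the channel state. -/
structure IsDecodable (T : ι → Set (Fin n → α)) (L : ι → α → Y → ℝ) (obs : ι → (ι → α) × S → Y)
    (τ : ι → ℝ) (C : Codebook κ n α) (m : ∀ i, κ i) (s : Fin n → S) : Prop where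
  mem : ∀ i, C ⟨i, m i⟩ ∈ T i
  le_score : ∀ i, τ i ≤ blockScore (L i) (C ⟨i, m i⟩) fun t => obs i (C.word m t, s t)
  score_lt : ∀ i, ∀ m' ≠ m i, blockScore (L i) (C ⟨i, m'⟩) (fun t => obs i (C.word m t, s t)) < τ i

/-- Law of the channel states during a block with inputs `x`, for a memoryless channel. -/
abbrev blockLaw (K : (ι → α) → S → ℝ) (x : Fin n → ι → α) : (Fin n → S) → ℝ :=
  piLaw fun t => K (x t)

theorem blockLaw_mem_stdSimplex [Fintype S] {K : (ι → α) → S → ℝ} (hK : ∀ x, K x ∈ stdSimplex ℝ S)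
    (x : Fin n → ι → α) : blockLaw K x ∈ stdSimplex ℝ (Fin n → S) :=
  piLaw_mem_stdSimplex fun t => hK (x t)

variable [Fintype ι] [∀ i, Fintype (κ i)]

/-- Law of a random codebook whose letters are independent, those of sender `i` of law `P i`. -/
def ensembleLaw (P : ι → α → ℝ) : Codebook κ n α → ℝ := piLaw fun k => iidLaw n (P k.1)

/-- Joint law of a random codebook and of the channel states during the transmission of `m`. -/
def transmissionLaw (P : ι → α → ℝ) (K : (ι → α) → S → ℝ) (m : ∀ i, κ i) :
    Codebook κ n α × (Fin n → S) → ℝ :=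
  compProd (ensembleLaw P) fun C => blockLaw K (C.word m)

variable [Fintype α] [Fintype S] [DecidableEq ι] [∀ i, DecidableEq (κ i)]
  {P : ι → α → ℝ} {K : (ι → α) → S → ℝ}

theorem ensembleLaw_mem_stdSimplex (hP : ∀ i, P i ∈ stdSimplex ℝ α) :
    (ensembleLaw P : Codebook κ n α → ℝ) ∈ stdSimplex ℝ (Codebook κ n α) :=
  piLaw_mem_stdSimplex fun k => piLaw_mem_stdSimplex fun _ => hP k.1

theorem transmissionLaw_mem_stdSimplex (hP : ∀ i, P i ∈ stdSimplex ℝ α)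
    (hK : ∀ x, K x ∈ stdSimplex ℝ S) (m : ∀ i, κ i) :
    transmissionLaw P K m ∈ stdSimplex ℝ (Codebook κ n α × (Fin n → S)) :=
  compProd_mem_stdSimplex (ensembleLaw_mem_stdSimplex hP) fun C =>
    blockLaw_mem_stdSimplex hK (C.word m)

section Law

variable [DecidableEq α]

theorem prob_ensembleLaw_word (hP : ∀ i, P i ∈ stdSimplex ℝ α) (m : ∀ i, κ i) :
    prob (ensembleLaw P : Codebook κ n α → ℝ) (fun C => C.word m) = iidLaw n (piLaw P) := by
  have hσ : Function.Injective fun i => (⟨i, m i⟩ : Σ i, κ i) := fun i j h =>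
    congrArg Sigma.fst h
  have h := prob_piLaw_comp_injective (w := fun k : Σ i, κ i => iidLaw n (P k.1))
    (fun k => piLaw_mem_stdSimplex fun _ => hP k.1) hσ
  change prob (ensembleLaw P) (Equiv.piComm (fun _ _ => α) ∘ fun C i => C ⟨i, m i⟩) = _
  rw [← prob_prob]
  ext x
  rw [prob_equiv]
  refine (congrFun h _).trans ?_
  simp only [piLaw, Function.comp_apply]
  exact Finset.prod_comm

theorem prob_transmissionLaw_codeword (hP : ∀ i, P i ∈ stdSimplex ℝ α)
    (hK : ∀ x, K x ∈ stdSimplex ℝ S) (m : ∀ i, κ i) (k : Σ i, κ i) :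
    prob (transmissionLaw (n := n) P K m) (fun ω => ω.1 k) = iidLaw n (P k.1) := by
  have h := prob_compProd_fst (ensembleLaw P) fun C : Codebook κ n α =>
    blockLaw_mem_stdSimplex hK (C.word m)
  calc prob (transmissionLaw P K m) (fun ω => ω.1 k)
      = prob (ensembleLaw P) (fun C : Codebook κ n α => C k) := by
        rw [← h, prob_prob]
        rfl
    _ = iidLaw n (P k.1) := prob_piLaw_eval (w := fun k : Σ i, κ i => iidLaw n (P k.1))
        (fun k => piLaw_mem_stdSimplex fun _ => hP k.1) k

theorem prob_transmissionLaw_letters [DecidableEq S] (hP : ∀ i, P i ∈ stdSimplex ℝ α)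
    (m : ∀ i, κ i) :
    prob (transmissionLaw (n := n) P K m) (fun ω t => (ω.1.word m t, ω.2 t)) =
      iidLaw n (compProd (piLaw P) K) := by
  change prob _ ((Equiv.arrowProdEquivProdArrow _ _ _).symm ∘
    Prod.map (fun C : Codebook κ n α => C.word m) id) = _
  rw [← prob_prob, transmissionLaw, prob_compProd_map, prob_ensembleLaw_word hP]
  ext x
  rw [prob_equiv]
  exact prod_mul_distrib.symm

end Law

theorem mass_le_blockScore_le_inv {P : α → ℝ} (hP : ∀ a, 0 ≤ P a) {L : α → Y → ℝ}
    (hL : ∀ a y, 0 ≤ L a y) (hPL : ∀ y, ∑ a, P a * L a y ≤ 1) {τ : ℝ} (hτ : 0 < τ)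
    (o : Fin n → Y) : mass (iidLaw n P) {c | τ ≤ blockScore L c o} ≤ τ⁻¹ := by
  refine (mass_le_inv_mul_sum (fun c => prod_nonneg fun _ _ => hP _)
    (fun c => prod_nonneg fun _ _ => hL _ _) hτ).trans
      (mul_le_of_le_one_right (inv_nonneg.2 hτ.le) ?_)
  calc ∑ c, iidLaw n P c * blockScore L c o = ∑ c : Fin n → α, ∏ t, P (c t) * L (c t) (o t) := by
        simp only [piLaw, blockScore, prod_mul_distrib]
    _ = ∏ t, ∑ a, P a * L a (o t) := sum_prod_eq_prod_sum fun t a => P a * L a (o t)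
    _ ≤ 1 := prod_le_one (fun t _ => sum_nonneg fun a _ => mul_nonneg (hP a) (hL a _))
        fun t _ => hPL _

theorem mass_wrong_codeword_le_inv (hP : ∀ i, P i ∈ stdSimplex ℝ α)
    (hK : ∀ x, K x ∈ stdSimplex ℝ S) {i : ι} {L : α → Y → ℝ} (hL : ∀ a y, 0 ≤ L a y)
    (hPL : ∀ y, ∑ a, P i a * L a y ≤ 1) (obs : (ι → α) × S → Y) {τ : ℝ} (hτ : 0 < τ)
    {m : ∀ i, κ i} {m' : κ i} (hm' : m' ≠ m i) :
    mass (transmissionLaw (n := n) P K m)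
      {ω | τ ≤ blockScore L (ω.1 ⟨i, m'⟩) fun t => obs (ω.1.word m t, ω.2 t)} ≤ τ⁻¹ := by
  have hword : ∀ (C : Codebook κ n α) c,
      Codebook.word (Function.update C ⟨i, m'⟩ c) m = C.word m := by
    intro C c
    ext t j
    refine congrFun (Function.update_of_ne (fun h => hm' ?_) c C) t
    cases h
    rfl
  -- a wrong codeword is independent of the transmission, so it may be drawn afresh
  have hfresh : ∀ C : Codebook κ n α, ∑ c, iidLaw n (P i) c * mass (blockLaw K (C.word m))
      {s | τ ≤ blockScore L c fun t => obs (C.word m t, s t)} ≤ τ⁻¹ := by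
    intro C
    have hs := blockLaw_mem_stdSimplex hK (C.word m)
    rw [sum_mul_mass_comm]
    calc _ ≤ ∑ s, blockLaw K (C.word m) s * τ⁻¹ := sum_le_sum fun s _ =>
          mul_le_mul_of_nonneg_left (mass_le_blockScore_le_inv (hP i).1 hL hPL hτ _) (hs.1 s)
      _ = τ⁻¹ := by rw [← sum_mul, hs.2, one_mul]
  have hens := ensembleLaw_mem_stdSimplex (κ := κ) (n := n) hP
  rw [transmissionLaw, mass_compProd, ensembleLaw, ← sum_piLaw_update _ ⟨i, m'⟩
    (piLaw_mem_stdSimplex fun _ => hP i).2]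
  simp only [hword, Set.mem_ofPred_eq, Function.update_self]
  calc _ ≤ ∑ C, (ensembleLaw P : Codebook κ n α → ℝ) C * τ⁻¹ := sum_le_sum fun C _ =>
        mul_le_mul_of_nonneg_left (hfresh C) (hens.1 C)
    _ = τ⁻¹ := by rw [← sum_mul, hens.2, one_mul]

theorem mass_not_isDecodable_le (hP : ∀ i, P i ∈ stdSimplex ℝ α)
    (hK : ∀ x, K x ∈ stdSimplex ℝ S) {L : ι → α → Y → ℝ} (hL : ∀ i a y, 0 ≤ L i a y)
    (hPL : ∀ i y, ∑ a, P i a * L i a y ≤ 1) (T : ι → Set (Fin n → α))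
    (obs : ι → (ι → α) × S → Y) {τ : ι → ℝ} (hτ : ∀ i, 0 < τ i) (m : ∀ i, κ i) :
    mass (transmissionLaw P K m) {ω | ¬ IsDecodable T L obs τ ω.1 m ω.2} ≤
      ∑ i, (mass (iidLaw n (P i)) (T i)ᶜ +
        mass (iidLaw n (compProd (piLaw P) K))
          {x | blockScore (L i) (fun t => (x t).1 i) (fun t => obs i (x t)) < τ i} +
        (Fintype.card (κ i) - 1) * (τ i)⁻¹) := by
  classical
  have hμ := (transmissionLaw_mem_stdSimplex (n := n) hP hK m).1
  let bad₁ i := {ω : Codebook κ n α × (Fin n → S) | ω.1 ⟨i, m i⟩ ∉ T i}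
  let o i (ω : Codebook κ n α × (Fin n → S)) t := obs i (ω.1.word m t, ω.2 t)
  let bad₂ i := {ω | blockScore (L i) (ω.1 ⟨i, m i⟩) (o i ω) < τ i}
  let bad₃ i (m' : {m' // m' ≠ m i}) := {ω | τ i ≤ blockScore (L i) (ω.1 ⟨i, m'⟩) (o i ω)}
  have hsub : {ω | ¬ IsDecodable T L obs τ ω.1 m ω.2} ⊆
      ⋃ i, (bad₁ i ∪ bad₂ i ∪ ⋃ m', bad₃ i m') := by
    intro ω hω
    contrapose! hω
    simp only [bad₁, bad₂, bad₃, Set.mem_iUnion, Set.mem_union, Set.mem_ofPred_eq, not_exists,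
      not_or, not_not, not_lt, not_le, Subtype.forall] at hω ⊢
    exact ⟨fun i => (hω i).1.1, fun i => (hω i).1.2, fun i => (hω i).2⟩
  refine (mass_mono hμ hsub).trans ((mass_iUnion_le hμ _).trans (sum_le_sum fun i _ => ?_))
  refine (mass_union_le hμ _ _).trans (add_le_add ((mass_union_le hμ _ _).trans
    (add_le_add (le_of_eq ?_) (le_of_eq ?_))) ((mass_iUnion_le hμ _).trans ?_))
  · rw [← prob_transmissionLaw_codeword hP hK m ⟨i, m i⟩, mass_prob]
    rfl
  · rw [← prob_transmissionLaw_letters hP m, mass_prob]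
    rfl
  · calc _ ≤ ∑ _ : {m' // m' ≠ m i}, (τ i)⁻¹ := sum_le_sum fun m' _ =>
          mass_wrong_codeword_le_inv hP hK (hL i) (hPL i) (obs i) (hτ i) m'.2
      _ = (Fintype.card (κ i) - 1) * (τ i)⁻¹ := by
          rw [sum_const, nsmul_eq_mul, card_univ, Fintype.card_subtype_compl,
            Fintype.card_subtype_eq, Nat.cast_sub (Fintype.card_pos_iff.2 ⟨m i⟩), Nat.cast_one]

theorem exists_codebook_of_mass_le (hP : ∀ i, P i ∈ stdSimplex ℝ α)
    {D : Codebook κ n α → (∀ i, κ i) → (Fin n → S) → Prop} {b : ℝ}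
    (hb : ∀ m, mass (transmissionLaw P K m) {ω | D ω.1 m ω.2} ≤ b) :
    ∃ C : Codebook κ n α, ∑ m, mass (blockLaw K (C.word m)) {s | D C m s} ≤
      b * ∏ i, (Fintype.card (κ i) : ℝ) := by
  refine exists_le_of_sum_mul_le (ensembleLaw_mem_stdSimplex hP) ?_
  simp only [mul_sum]
  rw [sum_comm]
  calc _ = ∑ m : ∀ i, κ i, mass (transmissionLaw P K m) {ω | D ω.1 m ω.2} := by
        simp only [transmissionLaw, mass_compProd]
        rfl
    _ ≤ ∑ _ : ∀ i, κ i, b := sum_le_sum fun m _ => hb m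
    _ = b * ∏ i, (Fintype.card (κ i) : ℝ) := by
        simp [Fintype.card_pi, mul_comm]

theorem tendsto_mass_prod_lt {Ω : Type*} [Fintype Ω] {μ : Ω → ℝ} (hμ : μ ∈ stdSimplex ℝ Ω)
    {f : Ω → ℝ} (hf : ∀ ω, 0 < μ ω → 0 < f ω) {θ : ℝ} (hθ : θ < ∑ ω, μ ω * Real.logb 2 (f ω)) :
    Tendsto (fun n : ℕ => mass (iidLaw n μ) {x | ∏ t, f (x t) < 2 ^ (n * θ)}) atTop (𝓝 0) := by
  have hμn := fun n : ℕ => (piLaw_mem_stdSimplex fun _ : Fin n => hμ).1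
  refine squeeze_zero (fun n => mass_nonneg (hμn n) _) (fun n => mass_le_of_imp (hμn n) ?_)
    (tendsto_mass_iidLaw_sum_le hμ _ hθ)
  intro x hx (hlt : ∏ t, f (x t) < 2 ^ (n * θ))
  have hpos : ∀ t, 0 < f (x t) := fun t => hf _ (pos_of_piLaw_pos (fun _ => hμ.1) hx t)
  rw [Set.mem_ofPred_eq, ← Real.logb_prod _ _ fun t _ => (hpos t).ne']
  exact (Real.logb_le_iff_le_rpow one_lt_two (prod_pos fun t _ => hpos t)).2 hlt.le

theorem tendsto_ceil_sub_one_mul_inv {R θ : ℝ} (h : R < θ) :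
    Tendsto (fun n : ℕ => ((⌈(2 : ℝ) ^ (n * R)⌉₊ : ℝ) - 1) * ((2 : ℝ) ^ (n * θ))⁻¹) atTop
      (𝓝 0) := by
  have hρ : (2 : ℝ) ^ (R - θ) < 1 := Real.rpow_lt_one_of_one_lt_of_neg one_lt_two (by linarith)
  refine squeeze_zero (fun n => ?_) (fun n => ?_)
    (tendsto_pow_atTop_nhds_zero_of_lt_one (by positivity) hρ)
  · have : 1 ≤ ⌈(2 : ℝ) ^ (n * R)⌉₊ := Nat.one_le_ceil_iff.2 (by positivity)
    have : (1 : ℝ) ≤ ⌈(2 : ℝ) ^ (n * R)⌉₊ := by exact_mod_cast this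
    exact mul_nonneg (by linarith) (by positivity)
  · have := Nat.ceil_lt_add_one (a := (2 : ℝ) ^ (n * R)) (by positivity)
    calc _ ≤ (2 : ℝ) ^ (n * R) * ((2 : ℝ) ^ (n * θ))⁻¹ := by gcongr; linarith
      _ = ((2 : ℝ) ^ (R - θ)) ^ n := by
        rw [← Real.rpow_neg two_pos.le, ← Real.rpow_add two_pos, ← Real.rpow_mul_natCast two_pos.le]
        congr 1
        ring

theorem eventually_exists_codebook (hP : ∀ i, P i ∈ stdSimplex ℝ α)
    (hK : ∀ x, K x ∈ stdSimplex ℝ S) {L : ι → α → Y → ℝ} (hL : ∀ i a y, 0 ≤ L i a y)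
    (hPL : ∀ i y, ∑ a, P i a * L i a y ≤ 1) {obs : ι → (ι → α) × S → Y}
    (hpos : ∀ i ω, 0 < compProd (piLaw P) K ω → 0 < L i (ω.1 i) (obs i ω))
    {T : ∀ n : ℕ, ι → Set (Fin n → α)}
    (hT : ∀ i, Tendsto (fun n => mass (iidLaw n (P i)) (T n i)ᶜ) atTop (𝓝 0)) {R : ι → ℝ}
    (hR : ∀ i, R i < ∑ ω, compProd (piLaw P) K ω * Real.logb 2 (L i (ω.1 i) (obs i ω)))
    {δ : ℝ} (hδ : 0 < δ) :
    ∀ᶠ n : ℕ in atTop, ∃ τ, ∃ C : Codebook (fun i => Fin ⌈(2 : ℝ) ^ (n * R i)⌉₊) n α,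
      ∑ m, mass (blockLaw K (C.word m)) {s | ¬ IsDecodable (T n) L obs τ C m s} ≤
        δ * ∏ i, (⌈(2 : ℝ) ^ (n * R i)⌉₊ : ℝ) := by
  choose θ hRθ hθ using fun i => exists_between (hR i)
  have hμ := compProd_mem_stdSimplex (piLaw_mem_stdSimplex hP) hK
  have hlim : Tendsto (fun n : ℕ => ∑ i, (mass (iidLaw n (P i)) (T n i)ᶜ +
      mass (iidLaw n (compProd (piLaw P) K))
        {x | ∏ t, L i ((x t).1 i) (obs i (x t)) < 2 ^ (n * θ i)} +
      ((⌈(2 : ℝ) ^ (n * R i)⌉₊ : ℝ) - 1) * ((2 : ℝ) ^ (n * θ i))⁻¹)) atTop (𝓝 0) := by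
    simpa using tendsto_finsetSum univ fun i _ => ((hT i).add
      (tendsto_mass_prod_lt hμ (hpos i) (hθ i))).add (tendsto_ceil_sub_one_mul_inv (hRθ i))
  filter_upwards [hlim.eventually (ge_mem_nhds hδ)] with n hn
  have hτ : ∀ i, (0 : ℝ) < 2 ^ (n * θ i) := fun i => by positivity
  obtain ⟨C, hC⟩ := exists_codebook_of_mass_le hP (b := δ)
    (D := fun C m s => ¬ IsDecodable (T n) L obs _ C m s) fun m =>
    (mass_not_isDecodable_le (κ := fun i => Fin ⌈(2 : ℝ) ^ (n * R i)⌉₊) hP hK hL hPL (T n) obs hτ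
      m).trans (by simpa only [Fintype.card_fin, blockScore] using hn)
  exact ⟨_, C, by simpa only [Fintype.card_fin] using hC⟩

end RandomCoding

/-! ### The Gaussian noise -/

section Noise

theorem integrable_exp_neg_sq_div_two :
    MeasureTheory.Integrable fun u : ℝ => Real.exp (-u ^ 2 / 2) := by
  simpa [neg_div, div_eq_inv_mul] using integrable_exp_neg_mul_sq (b := 1 / 2) (by norm_num)

theorem gaussQ_strictAnti : StrictAnti gaussQ := by
  intro a b hab
  have hi := integrable_exp_neg_sq_div_two
  have h := intervalIntegral.integral_Ioi_sub_Ioi (a := a) (b := b) hi.integrableOn hab.le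
  have hpos : 0 < ∫ u in a..b, Real.exp (-u ^ 2 / 2) :=
    intervalIntegral.intervalIntegral_pos_of_pos hi.intervalIntegrable
      (fun u => Real.exp_pos _) hab
  exact mul_lt_mul_of_pos_left (sub_pos.1 (h ▸ hpos)) (by positivity)

theorem gaussQ_zero : gaussQ 0 = 1 / 2 := by
  have h : ∫ u in Set.Ioi (0 : ℝ), Real.exp (-u ^ 2 / 2) = √(2 * Real.pi) / 2 := by
    simpa [neg_div, div_eq_inv_mul, mul_comm] using integral_gaussian_Ioi (1 / 2)
  have hπ : √(2 * Real.pi) ≠ 0 := by positivity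
  rw [gaussQ, h]
  field_simp

theorem two_mul_gaussQ_lt_one {β : ℝ} (hβ : 0 < β) : 2 * gaussQ β < 1 := by
  linarith [gaussQ_strictAnti hβ, gaussQ_zero]

theorem sum_Ico_int_sub {G : Type*} [AddCommGroup G] (F : ℤ → G) {a b : ℤ} (hab : a ≤ b) :
    ∑ k ∈ Ico a b, (F k - F (k + 1)) = F a - F b := by
  induction b, hab using Int.leInduction with
  | base => simp
  | succ n hn ih =>
    rw [← insert_Ico_right_eq_Ico_add_one hn, sum_insert right_notMem_Ico, ih]
    abel

variable {A β γ : ℝ}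

theorem cellMass_nonneg (hγ : 0 < γ) (k : ℤ) : 0 ≤ cellMass β γ k := by
  refine sub_nonneg.2 (gaussQ_strictAnti.antitone ?_)
  gcongr
  linarith

theorem noiseProb_mem_stdSimplex (N : ℕ) (hA : 0 ≤ A) (hβ : 0 < β) (hγ : 0 < γ) :
    noiseProb N A β γ ∈ stdSimplex ℝ (Fin N → Bool) := by
  have hlt : -⌈γ * A⌉ < ⌈γ * (A + 2 * β)⌉ := by
    have h₁ : 0 ≤ ⌈γ * A⌉ := Int.ceil_nonneg (by positivity)
    have h₂ : 0 < ⌈γ * (A + 2 * β)⌉ := Int.ceil_pos.2 (by positivity)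
    omega
  have htotal : 0 < gaussQ ((-⌈γ * A⌉ - γ * β) / γ) -
      gaussQ ((⌈γ * (A + 2 * β)⌉ - γ * β) / γ) := by
    refine sub_pos.2 (gaussQ_strictAnti ?_)
    gcongr
    exact_mod_cast hlt
  refine ⟨fun z => div_nonneg (sum_nonneg fun k _ => cellMass_nonneg hγ k) htotal.le, ?_⟩
  have hsum := sum_Ico_int_sub (fun k : ℤ => gaussQ ((k - γ * β) / γ)) hlt.le
  push_cast at hsum
  unfold noiseProb
  rw [← sum_div, sum_fiberwise]
  simp only [cellMass, hsum]
  exact div_self htotal.ne'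

end Noise

/-! ### The channel -/

section Channel

/-- The Bernoulli law with parameter `p`. -/
def bern (p : ℝ) (x : Bool) : ℝ := if x then p else 1 - p

theorem bern_mem_stdSimplex {p : ℝ} (hp : 0 ≤ p ∧ p ≤ 1) : bern p ∈ stdSimplex ℝ Bool :=
  ⟨fun x => by cases x <;> simp [bern, hp.1, hp.2], by simp [bern]⟩

variable {N : ℕ} {A β γ ε : ℝ} {e : (Fin N → Bool) → ℝ} {p : Fin N → ℝ}

theorem inputProb_mem_stdSimplex (hp : ∀ i, 0 ≤ p i ∧ p i ≤ 1) :
    inputProb p ∈ stdSimplex ℝ (Fin N → Bool) :=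
  piLaw_mem_stdSimplex fun i => bern_mem_stdSimplex (hp i)

theorem stateProb_mem_stdSimplex (hZ : noiseProb N A β γ ∈ stdSimplex ℝ (Fin N → Bool))
    (he : ∀ x, 0 ≤ e x ∧ e x ≤ 1) (x : Fin N → Bool) :
    stateProb A β γ e x ∈ stdSimplex ℝ (State N) :=
  compProd_mem_stdSimplex (K := fun _ => bern (e x)) hZ fun _ => bern_mem_stdSimplex (he x)

theorem jointLaw_mem_stdSimplex (hZ : noiseProb N A β γ ∈ stdSimplex ℝ (Fin N → Bool))
    (he : ∀ x, 0 ≤ e x ∧ e x ≤ 1) (hp : ∀ i, 0 ≤ p i ∧ p i ≤ 1) :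
    jointLaw A β γ e p ∈ stdSimplex ℝ ((Fin N → Bool) × State N) :=
  compProd_mem_stdSimplex (inputProb_mem_stdSimplex hp) (stateProb_mem_stdSimplex hZ he)

theorem prob_jointLaw_input (hZ : noiseProb N A β γ ∈ stdSimplex ℝ (Fin N → Bool))
    (he : ∀ x, 0 ≤ e x ∧ e x ≤ 1) (hp : ∀ i, 0 ≤ p i ∧ p i ≤ 1) (i : Fin N) :
    prob (jointLaw A β γ e p) (fun ω => ω.1 i) = bern (p i) := by
  have hX : prob (jointLaw A β γ e p) Prod.fst = inputProb p :=
    prob_compProd_fst (inputProb p) (stateProb_mem_stdSimplex hZ he)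
  have hXi : prob (inputProb p) (fun x => x i) = bern (p i) :=
    prob_piLaw_eval (fun j => bern_mem_stdSimplex (hp j)) i
  rw [← hXi, ← hX, prob_prob]
  rfl

theorem cdObs_zero_ne_none_iff {q : ℕ} (i : Fin N) (ω : (Fin N → Bool) × State N) :
    cdObs q i ω 0 ≠ none ↔ ω.2.2 = false := by
  rcases ω with ⟨x, z, b⟩
  cases b <;> simp [cdObs, output]

theorem sum_jointLaw_not_erased (hZ : noiseProb N A β γ ∈ stdSimplex ℝ (Fin N → Bool))
    (p : Fin N → ℝ) (q : ℕ) (i : Fin N) :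
    ∑ ω with cdObs q i ω 0 ≠ none, jointLaw A β γ e p ω = ∑ x, inputProb p x * (1 - e x) := by
  simp only [cdObs_zero_ne_none_iff, sum_filter, Fintype.sum_prod_type]
  simp [jointLaw, stateProb, ← mul_sum, ← sum_mul, hZ.2]

theorem one_sub_le_sum_jointLaw_not_erased
    (hZ : noiseProb N A β γ ∈ stdSimplex ℝ (Fin N → Bool)) (he : ∀ x, e x ≤ ε)
    (hp : ∀ i, 0 ≤ p i ∧ p i ≤ 1) (q : ℕ) (i : Fin N) :
    1 - ε ≤ ∑ ω with cdObs q i ω 0 ≠ none, jointLaw A β γ e p ω := by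
  have hX := inputProb_mem_stdSimplex hp
  calc 1 - ε = ∑ x, inputProb p x * (1 - ε) := by rw [← sum_mul, hX.2, one_mul]
    _ ≤ ∑ x, inputProb p x * (1 - e x) := sum_le_sum fun x _ =>
      mul_le_mul_of_nonneg_left (by linarith [he x]) (hX.1 x)
    _ = _ := (sum_jointLaw_not_erased hZ p q i).symm

end Channel

/-! ### The maximum of the rate expression -/

section Max

variable {N : ℕ} {A E β γ ε : ℝ} {e : (Fin N → Bool) → ℝ}

theorem continuous_jointLaw (A β γ : ℝ) (e : (Fin N → Bool) → ℝ) :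
    Continuous fun p : Fin N → ℝ => jointLaw A β γ e p := by
  refine continuous_pi fun ω => (continuous_finsetProd _ fun i _ => ?_).mul continuous_const
  split_ifs <;> fun_prop

theorem continuousOn_cdInfo (hZ : noiseProb N A β γ ∈ stdSimplex ℝ (Fin N → Bool)) (hε : ε < 1)
    (he : ∀ x, 0 ≤ e x ∧ e x ≤ ε) (q : ℕ) (i : Fin N) :
    ContinuousOn (fun p => cdInfo A β γ e q p i) {p | ∀ i, 0 ≤ p i ∧ p i ≤ 1} := by
  refine (continuousOn_mutualInfo (fun ω : (Fin N → Bool) × State N => ω.1 i) (cdObs q i)).comp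
    (f := fun p => condLaw (jointLaw A β γ e p) fun ω => cdObs q i ω 0 ≠ none) ?_
    fun p hp => condLaw_nonneg (jointLaw_mem_stdSimplex hZ
      (fun x => ⟨(he x).1, (he x).2.trans hε.le⟩) hp).1 _
  refine continuousOn_pi.2 fun ω => ?_
  have hjoint : ∀ ω, Continuous fun p => jointLaw A β γ e p ω := fun ω =>
    (continuous_apply ω).comp (continuous_jointLaw A β γ e)
  unfold condLaw
  split_ifs
  · refine (hjoint ω).continuousOn.div
      (continuous_finsetSum _ fun ω' _ => hjoint ω').continuousOn fun p hp => ?_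
    have := one_sub_le_sum_jointLaw_not_erased hZ (fun x => (he x).2) hp q i
    exact (lt_of_lt_of_le (sub_pos.2 hε) this).ne'
  · exact continuousOn_const

theorem sum_filter_pos_mul {ι : Type*} [Fintype ι] {p : ι → ℝ} (hp : ∀ i, 0 ≤ p i) (w : ι → ℝ) :
    ∑ i with 0 < p i, p i * w i = ∑ i, p i * w i :=
  sum_filter_of_ne fun i _ hi => (hp i).lt_of_ne' (left_ne_zero_of_mul hi)

theorem isClosed_sum_filter_pos_le {ι : Type*} [Fintype ι] {w : ι → ℝ} (hw : ∀ i, 0 ≤ w i)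
    (b : ℝ) : IsClosed {p : ι → ℝ | ∑ i with 0 < p i, w i ≤ b} := by
  have h : LowerSemicontinuous fun p : ι → ℝ => ∑ i, {p : ι → ℝ | 0 < p i}.indicator
      (fun _ => w i) p :=
    lowerSemicontinuous_sum fun i _ =>
      (isOpen_lt continuous_const (continuous_apply i)).lowerSemicontinuous_indicator (hw i)
  simpa [Set.preimage, sum_filter, Set.indicator_apply] using h.isClosed_preimage b

theorem isCompact_feasible (A E γ : ℝ) : IsCompact {p : Fin N → ℝ | Feasible A E γ p} := by
  have h : {p : Fin N → ℝ | Feasible A E γ p} = Set.Icc 0 1 ∩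
      ({p | ∑ i : Fin N with 0 < p i, (2 : ℝ) ^ (i : ℕ) ≤ γ * A} ∩
        {p | ∑ i : Fin N, p i * (2 : ℝ) ^ (i : ℕ) ≤ γ * E}) := by
    ext p
    simp only [Feasible, Set.mem_ofPred_eq, Set.mem_inter_iff, Set.mem_Icc, Pi.le_def,
      Pi.zero_apply, Pi.one_apply, ← forall_and]
    exact and_congr_right fun hp => by rw [sum_filter_pos_mul fun i => (hp i).1]
  rw [h]
  refine isCompact_Icc.inter_right ((isClosed_sum_filter_pos_le (fun i => by positivity) _).inter
    (isClosed_le (by fun_prop) continuous_const))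

theorem exists_isMaxOn_sum_cdInfo (hA : 0 ≤ A) (hE : 0 ≤ E) (hγ : 0 ≤ γ)
    (hZ : noiseProb N A β γ ∈ stdSimplex ℝ (Fin N → Bool)) (hε : ε < 1)
    (he : ∀ x, 0 ≤ e x ∧ e x ≤ ε) (q : ℕ) :
    ∃ p : Fin N → ℝ, Feasible A E γ p ∧
      IsMaxOn (fun p => ∑ i, cdInfo A β γ e q p i) {p | Feasible A E γ p} p :=
  (isCompact_feasible A E γ).exists_isMaxOn
    ⟨0, by simp [Feasible, mul_nonneg hγ hA, mul_nonneg hγ hE]⟩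
    (continuousOn_finsetSum _ fun i _ =>
      (continuousOn_cdInfo hZ hε he q i).mono fun _ hp => hp.1)

end Max

/-! ### Successive decoding -/

section Decode

variable {N q n : ℕ}

theorem rxCarry_output {x x' z : Fin N → Bool} {k : ℕ} (hk : k ≤ N)
    (h : ∀ j : Fin N, (j : ℕ) < k → x' j = x j) :
    ∀ j ≤ k, rxCarry x' (output x (z, false)) j = carry x z j := by
  intro j
  induction j with
  | zero => exact fun _ => rfl
  | succ j ih =>
    intro hj
    have hjN : j < N := by lia
    have hx : ext x' j = ext x j := by simpa [ext, hjN] using h ⟨j, hjN⟩ hj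
    have hy : outputExt (output x (z, false)) j = some (ext x j ^^ ext z j ^^ carry x z j) := by
      simp [outputExt, output, ext, hjN]
    rw [rxCarry, carry, ih (by lia), hy, hx]
    cases ext x j <;> cases ext z j <;> cases carry x z j <;> rfl

theorem rxObs_eq_cdObs {x x' : Fin N → Bool} {i : Fin N} (h : ∀ j < i, x' j = x j)
    (s : State N) : rxObs q i x' (output x s) = cdObs q i (x, s) := by
  obtain ⟨z, _ | _⟩ := s
  · simp only [rxObs, cdObs, rxCarry_output i.2.le (fun j hj => h j hj) i le_rfl]
  · simp [rxObs, cdObs, output]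

theorem CDCode.decodeUpTo_eq (c : CDCode N q n) {m : c.Msg} {s : Fin n → State N}
    (h : ∀ i, c.dec i (fun t => cdObs q i (c.word m t, s t)) = m i) {k : ℕ} (hk : k ≤ N)
    {j : Fin N} (hj : (j : ℕ) < k) :
    c.decodeUpTo (fun t => output (c.word m t) (s t)) k j = m j := by
  induction k generalizing j with
  | zero => exact absurd hj (Nat.not_lt_zero _)
  | succ k ih =>
    have hkN : k < N := hk
    rw [CDCode.decodeUpTo, dif_pos hkN]
    rcases Nat.lt_succ_iff_lt_or_eq.1 hj with hlt | heq
    · rw [Function.update_of_ne (by rintro rfl; exact lt_irrefl _ hlt)]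
      exact ih hkN.le hlt
    · obtain rfl : j = ⟨k, hkN⟩ := Fin.ext heq
      rw [Function.update_self, ← h ⟨k, hkN⟩]
      congr 1
      ext1 t
      refine rxObs_eq_cdObs (fun i hi => ?_) (s t)
      rw [CDCode.word, ih hkN.le hi, CDCode.word]

theorem CDCode.decode_eq (c : CDCode N q n) {m : c.Msg} {s : Fin n → State N}
    (h : ∀ i, c.dec i (fun t => cdObs q i (c.word m t, s t)) = m i) :
    c.decode (fun t => output (c.word m t) (s t)) = m :=
  funext fun j => c.decodeUpTo_eq h le_rfl j.2

theorem CDCode.errorProb_eq (c : CDCode N q n) (A β γ : ℝ) (e : (Fin N → Bool) → ℝ) :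
    c.errorProb A β γ e = (∑ m, mass (blockLaw (stateProb A β γ e) (c.word m))
      {s | c.decode (fun t => output (c.word m t) (s t)) ≠ m}) / ∏ i, (c.M i : ℝ) := by
  classical
  simp [CDCode.errorProb, mass_eq_sum_ite, piLaw]

end Decode

/-! ### Threshold codes -/

section ThresholdCode

variable {N q n : ℕ}

/-- The number of ones in a block. -/
def weight (c : Fin n → Bool) : ℝ := ∑ t, if c t then 1 else 0

theorem weight_nonpos_iff {c : Fin n → Bool} : weight c ≤ 0 ↔ ∀ t, c t = false := by
  have h : 0 ≤ weight c := sum_nonneg fun t _ => by positivity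
  rw [h.ge_iff_eq', weight, sum_eq_zero_iff_of_nonneg fun t _ => by positivity]
  simp

theorem sum_level_word (c : CDCode N q n) (m : c.Msg) :
    ∑ t, level (c.word m t) = ∑ i, weight (c.enc i (m i)) * (2 : ℝ) ^ (i : ℕ) := by
  simp only [level, weight, CDCode.word, sum_mul, ite_mul, one_mul, zero_mul]
  exact sum_comm

open Classical in
/-- The code made from the codebook `C`. Codewords of bit-pipe `i` of weight more than `n * b i` are
replaced by the zero block, which enforces the average constraint; the decoder of bit-pipe `i` picks
a message whose codeword has a score of at least `τ i`. -/
noncomputable def thresholdCode {M : Fin N → ℕ} (hM : ∀ i, 0 < M i)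
    (C : Codebook (fun i => Fin (M i)) n Bool) (b : Fin N → ℝ)
    (L : Fin N → Bool → (Fin (q + 1) → Option Bool) → ℝ) (τ : Fin N → ℝ) : CDCode N q n where
  M := M
  M_pos := hM
  enc i m := if weight (C ⟨i, m⟩) ≤ n * b i then C ⟨i, m⟩ else fun _ => false
  dec i o :=
    have : Nonempty (Fin (M i)) := ⟨⟨0, hM i⟩⟩
    Classical.epsilon fun m => τ i ≤ blockScore (L i) (C ⟨i, m⟩) o

variable {M : Fin N → ℕ} (hM : ∀ i, 0 < M i) {C : Codebook (fun i => Fin (M i)) n Bool}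
  {b : Fin N → ℝ} {L : Fin N → Bool → (Fin (q + 1) → Option Bool) → ℝ} {τ : Fin N → ℝ}

theorem word_thresholdCode {m : ∀ i, Fin (M i)} (h : ∀ i, weight (C ⟨i, m i⟩) ≤ n * b i) :
    (thresholdCode hM C b L τ).word m = C.word m := by
  ext t i
  simp [CDCode.word, thresholdCode, Codebook.word, h i]

theorem decode_thresholdCode {m : ∀ i, Fin (M i)} {s : Fin n → State N}
    (h : IsDecodable (fun i => {c | weight c ≤ n * b i}) L (cdObs q) τ C m s) :
    (thresholdCode hM C b L τ).decode
      (fun t => output ((thresholdCode hM C b L τ).word m t) (s t)) = m := by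
  refine CDCode.decode_eq _ fun i => ?_
  rw [word_thresholdCode hM h.mem]
  by_contra hne
  exact (h.score_lt i _ hne).not_ge (Classical.epsilon_spec (p := fun m' =>
    τ i ≤ blockScore (L i) (C ⟨i, m'⟩) fun t => cdObs q i (C.word m t, s t)) ⟨m i, h.le_score i⟩)

theorem errorProb_thresholdCode_le {A β γ δ : ℝ} {e : (Fin N → Bool) → ℝ}
    (hZ : noiseProb N A β γ ∈ stdSimplex ℝ (Fin N → Bool)) (he : ∀ x, 0 ≤ e x ∧ e x ≤ 1)
    (h : ∑ m, mass (blockLaw (stateProb A β γ e) (C.word m))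
      {s | ¬ IsDecodable (fun i => {c | weight c ≤ n * b i}) L (cdObs q) τ C m s} ≤
        δ * ∏ i, (M i : ℝ)) :
    (thresholdCode hM C b L τ).errorProb A β γ e ≤ δ := by
  have hK := stateProb_mem_stdSimplex hZ he
  rw [CDCode.errorProb_eq, div_le_iff₀ (prod_pos fun i _ => Nat.cast_pos.2 (hM i))]
  refine (sum_le_sum fun m _ => ?_).trans h
  by_cases hm : ∀ i, weight (C ⟨i, m i⟩) ≤ n * b i
  · rw [word_thresholdCode hM hm]
    refine mass_mono (blockLaw_mem_stdSimplex hK _).1 fun s hs hdec => hs ?_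
    rw [← word_thresholdCode hM hm]
    exact decode_thresholdCode hM hdec
  · have huniv : {s | ¬ IsDecodable (fun i => {c | weight c ≤ n * b i}) L (cdObs q) τ C m s} =
        Set.univ := Set.eq_univ_of_forall fun s hs => hm hs.mem
    rw [huniv, mass_univ (blockLaw_mem_stdSimplex hK _)]
    exact mass_le_one (blockLaw_mem_stdSimplex hK _) _

theorem weight_enc_thresholdCode_le (hb : ∀ i, 0 ≤ b i) (i : Fin N) (m : Fin (M i)) :
    weight ((thresholdCode hM C b L τ).enc i m) ≤ n * b i := by
  simp only [thresholdCode]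
  split_ifs with h
  · exact h
  · exact (weight_nonpos_iff.2 fun _ => rfl).trans (mul_nonneg n.cast_nonneg (hb i))

theorem admissible_thresholdCode {A E γ : ℝ} (hb : Feasible A E γ b)
    (hM₁ : ∀ i, b i = 0 → M i = 1) : (thresholdCode hM C b L τ).Admissible A E γ := by
  have hw := weight_enc_thresholdCode_le hM (C := C) (L := L) (τ := τ) fun i => (hb.1 i).1
  refine ⟨⟨univ.filter fun i => 0 < b i, hb.2.1, fun i hi => ?_⟩, fun m => ?_⟩
  · have hbi : b i = 0 := le_antisymm (by simpa using hi) (hb.1 i).1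
    exact ⟨hM₁ i hbi, fun m => weight_nonpos_iff.1 (by simpa [hbi] using hw i m)⟩
  · calc ∑ t, level ((thresholdCode hM C b L τ).word m t)
        ≤ ∑ i, (n * b i) * (2 : ℝ) ^ (i : ℕ) := by
          rw [sum_level_word]
          gcongr with i
          exact hw i (m i)
      _ = n * ∑ i with 0 < b i, b i * (2 : ℝ) ^ (i : ℕ) := by
          rw [sum_filter_pos_mul fun i => (hb.1 i).1, mul_sum]
          simp only [mul_assoc]
      _ ≤ n * (γ * E) := mul_le_mul_of_nonneg_left hb.2.2 n.cast_nonneg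

end ThresholdCode

/-! ### Achievability -/

section Achievability

theorem tendsto_mass_iidLaw_bern_weight {p b : ℝ} (hp : 0 ≤ p ∧ p ≤ 1)
    (h : p < b ∨ p = 0 ∧ b = 0) :
    Tendsto (fun n : ℕ => mass (iidLaw n (bern p)) {c | weight c ≤ n * b}ᶜ) atTop (𝓝 0) := by
  have hbern := bern_mem_stdSimplex hp
  rcases h with h | ⟨rfl, rfl⟩
  · simpa only [Set.compl_ofPred, not_le, weight] using
      tendsto_mass_iidLaw_lt_sum hbern (fun x => if x then 1 else 0) (by simpa [bern] using h)
  · have hzero : ∀ n : ℕ, mass (iidLaw n (bern 0)) {c | weight c ≤ n * 0}ᶜ = 0 := fun n =>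
      sum_eq_zero fun c _ => Set.indicator_apply_eq_zero.2 fun hc => by
        by_contra hne
        have hpos : 0 < iidLaw n (bern 0) c :=
          ((piLaw_mem_stdSimplex fun _ => hbern).1 c).lt_of_ne' hne
        refine hc ?_
        rw [Set.mem_ofPred_eq, mul_zero, weight_nonpos_iff]
        intro t
        simpa [bern] using (pos_of_piLaw_pos (fun _ => hbern.1) hpos t).ne'
    simp only [hzero, tendsto_const_nhds]

theorem exists_shrink_lt {ι : Type*} {F : (ι → ℝ) → ℝ}
    (hF : ContinuousOn F {p | ∀ i, 0 ≤ p i ∧ p i ≤ 1}) {p : ι → ℝ}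
    (hp : ∀ i, 0 ≤ p i ∧ p i ≤ 1) {b : ℝ} (hb : b < F p) :
    ∃ p' : ι → ℝ, (∀ i, 0 ≤ p' i ∧ p' i ≤ 1) ∧ (∀ i, p' i < p i ∨ p' i = 0 ∧ p i = 0) ∧
      b < F p' := by
  have hmem : ∀ l ∈ Set.Icc (0 : ℝ) 1, ∀ i, 0 ≤ (l • p) i ∧ (l • p) i ≤ 1 := fun l hl i =>
    ⟨mul_nonneg hl.1 (hp i).1, mul_le_one₀ hl.2 (hp i).1 (hp i).2⟩
  have hcont : ContinuousOn (fun l : ℝ => F (l • p)) (Set.Icc 0 1) :=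
    hF.comp (f := fun l : ℝ => l • p) (by fun_prop) hmem
  have hev : ∀ᶠ l in 𝓝[Set.Ico 0 1] (1 : ℝ), b < F (l • p) :=
    ((hcont 1 ⟨zero_le_one, le_rfl⟩).mono Set.Ico_subset_Icc_self).eventually
      (lt_mem_nhds (by simpa using hb))
  have : (𝓝[Set.Ico 0 1] (1 : ℝ)).NeBot := by
    rw [nhdsWithin_Ico_eq_nhdsLT one_pos]
    infer_instance
  obtain ⟨l, hl, hl01⟩ := (hev.and self_mem_nhdsWithin).exists
  refine ⟨l • p, hmem l (Set.Ico_subset_Icc_self hl01), fun i => ?_, hl⟩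
  rcases (hp i).1.eq_or_lt with h | h
  · exact Or.inr ⟨by simp [← h], h.symm⟩
  · exact Or.inl (mul_lt_of_lt_one_left h hl01.2)

theorem exists_forall_lt_le_sum {ι : Type*} [Fintype ι] {x : ι → ℝ} {b : ℝ} (h : b < ∑ i, x i) :
    ∃ y : ι → ℝ, (∀ i, y i < x i) ∧ b ≤ ∑ i, y i := by
  set κ := (∑ i, x i - b) / (Fintype.card ι + 1)
  have hκ0 : 0 < κ := div_pos (sub_pos.2 h) (by positivity)
  have hκ1 : (Fintype.card ι + 1) * κ = ∑ i, x i - b := mul_div_cancel₀ _ (by positivity)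
  refine ⟨fun i => x i - κ, fun i => sub_lt_self _ hκ0, ?_⟩
  rw [sum_sub_distrib, sum_const, card_univ, nsmul_eq_mul]
  linarith

variable {N q : ℕ} {A E β γ ε : ℝ} {e : (Fin N → Bool) → ℝ} {p : Fin N → ℝ}
  (hZ : noiseProb N A β γ ∈ stdSimplex ℝ (Fin N → Bool)) (hε : ε < 1)
  (he : ∀ x, 0 ≤ e x ∧ e x ≤ ε)

include hZ hε he

theorem condLaw_jointLaw_mem_stdSimplex (hp : ∀ i, 0 ≤ p i ∧ p i ≤ 1) (q : ℕ) (i : Fin N) :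
    (condLaw (jointLaw A β γ e p) fun ω => cdObs q i ω 0 ≠ none) ∈
      stdSimplex ℝ ((Fin N → Bool) × State N) :=
  condLaw_mem_stdSimplex
    (jointLaw_mem_stdSimplex hZ (fun x => ⟨(he x).1, (he x).2.trans hε.le⟩) hp).1
    ((sub_pos.2 hε).trans_le
      (one_sub_le_sum_jointLaw_not_erased hZ (fun x => (he x).2) hp q i)).ne'

theorem cdInfo_eq_zero (hp : ∀ i, 0 ≤ p i ∧ p i ≤ 1) {i : Fin N} (hpi : p i = 0) :
    cdInfo A β γ e q p i = 0 := by
  have he₁ : ∀ x, 0 ≤ e x ∧ e x ≤ 1 := fun x => ⟨(he x).1, (he x).2.trans hε.le⟩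
  have hJ := jointLaw_mem_stdSimplex hZ he₁ hp
  refine mutualInfo_eq_zero_of_const (a := false)
    (condLaw_jointLaw_mem_stdSimplex hZ hε he hp q i) _ fun ω hω => ?_
  have hpos := prob_apply_pos hJ.1 (fun ω => ω.1 i) (pos_of_condLaw_pos hJ.1 hω)
  rw [prob_jointLaw_input hZ he₁ hp, hpi] at hpos
  simpa [bern] using hpos.ne'

theorem one_sub_mul_cdInfo_le (hp : ∀ i, 0 ≤ p i ∧ p i ≤ 1) (i : Fin N) :
    (1 - ε) * cdInfo A β γ e q p i ≤ ∑ ω, jointLaw A β γ e p ω *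
      Real.logb 2 (condScore (jointLaw A β γ e p) (fun ω => ω.1 i) (cdObs q i)
        (fun o => o 0 ≠ none) (ω.1 i) (cdObs q i ω)) := by
  have hS := one_sub_le_sum_jointLaw_not_erased hZ (fun x => (he x).2) hp q i
  have hI : 0 ≤ cdInfo A β γ e q p i :=
    mutualInfo_nonneg (condLaw_jointLaw_mem_stdSimplex hZ hε he hp q i) _ _
  have hscore := mul_mutualInfo_condLaw_le (f := fun ω => ω.1 i) (g := cdObs q i)
    (S := fun o => o 0 ≠ none)
    (jointLaw_mem_stdSimplex hZ (fun x => ⟨(he x).1, (he x).2.trans hε.le⟩) hp)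
    ((sub_pos.2 hε).trans_le hS).ne'
  exact (mul_le_mul_of_nonneg_right hS hI).trans hscore

theorem eventually_exists_thresholdCode (hp : ∀ i, 0 ≤ p i ∧ p i ≤ 1) {b : Fin N → ℝ}
    (hb : ∀ i, p i < b i ∨ p i = 0 ∧ b i = 0) {R : Fin N → ℝ}
    (hR : ∀ i, R i < (1 - ε) * cdInfo A β γ e q p i) {δ : ℝ} (hδ : 0 < δ) :
    ∀ᶠ n : ℕ in atTop, ∃ (hM : ∀ i, 0 < ⌈(2 : ℝ) ^ (n * R i)⌉₊)
      (C : Codebook (fun i => Fin ⌈(2 : ℝ) ^ (n * R i)⌉₊) n Bool)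
      (L : Fin N → Bool → (Fin (q + 1) → Option Bool) → ℝ) (τ : Fin N → ℝ),
      (thresholdCode hM C b L τ).errorProb A β γ e ≤ δ := by
  have he₁ : ∀ x, 0 ≤ e x ∧ e x ≤ 1 := fun x => ⟨(he x).1, (he x).2.trans hε.le⟩
  have hJ := jointLaw_mem_stdSimplex hZ he₁ hp
  have hbook := eventually_exists_codebook (P := fun i => bern (p i)) (K := stateProb A β γ e)
    (L := fun i => condScore (jointLaw A β γ e p) (fun ω => ω.1 i) (cdObs q i) fun o => o 0 ≠ none)
    (obs := cdObs q) (T := fun n i => {c | weight c ≤ n * b i})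
    (fun i => bern_mem_stdSimplex (hp i)) (stateProb_mem_stdSimplex hZ he₁)
    (fun i a o => condScore_nonneg hJ.1 a o)
    (fun i o => by
      simpa only [prob_jointLaw_input hZ he₁ hp] using
        sum_prob_mul_condScore_le_one (f := fun ω => ω.1 i) (g := cdObs q i) hJ o)
    (fun i ω hω => condScore_pos (f := fun ω => ω.1 i) hJ.1 hω)
    (fun i => tendsto_mass_iidLaw_bern_weight (hp i) (hb i))
    (fun i => (hR i).trans_le (one_sub_mul_cdInfo_le hZ hε he hp i)) hδ
  filter_upwards [hbook] with n hn
  obtain ⟨τ, C, hC⟩ := hn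
  exact ⟨fun i => Nat.ceil_pos.2 (by positivity), C, _, τ,
    errorProb_thresholdCode_le _ hZ he₁ hC⟩

theorem cdAchieves_of_feasible (hp : Feasible A E γ p) (q : ℕ) :
    CDAchieves A E β γ e q ((1 - ε) * ∑ i, cdInfo A β γ e q p i) := by
  intro δ hδ
  have hcont : ContinuousOn (fun p => (1 - ε) * ∑ i, cdInfo A β γ e q p i)
      {p | ∀ i, 0 ≤ p i ∧ p i ≤ 1} :=
    (continuousOn_finsetSum _ fun i _ => continuousOn_cdInfo hZ hε he q i).const_mul _
  -- the slack `p' i < p i` makes random words meet the average constraint with high probability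
  obtain ⟨p', hp', hlt, hI⟩ := exists_shrink_lt hcont hp.1 (sub_lt_self _ hδ)
  rw [mul_sum univ (cdInfo A β γ e q p')] at hI
  obtain ⟨R, hR, hsum⟩ := exists_forall_lt_le_sum hI
  filter_upwards [eventually_exists_thresholdCode hZ hε he hp' hlt hR hδ] with n hn
  obtain ⟨hM, C, L, τ, herr⟩ := hn
  refine ⟨_, admissible_thresholdCode hM hp fun i hi => ?_, ?_, herr⟩
  · have hp'i : p' i = 0 := (hlt i).elim (fun h => absurd (hp' i).1 (by linarith)) And.left
    have hRi : R i < 0 := by simpa [cdInfo_eq_zero hZ hε he hp' hp'i] using hR i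
    refine le_antisymm (Nat.ceil_le.2 ?_) (hM i)
    rw [Nat.cast_one]
    exact Real.rpow_le_one_of_one_le_of_nonpos one_le_two
      (mul_nonpos_of_nonneg_of_nonpos n.cast_nonneg hRi.le)
  · calc n * ((1 - ε) * ∑ i, cdInfo A β γ e q p i - δ) ≤ n * ∑ i, R i :=
          mul_le_mul_of_nonneg_left hsum n.cast_nonneg
      _ = ∑ i, n * R i := mul_sum _ _ _
      _ ≤ _ := sum_le_sum fun i _ =>
          (Real.le_logb_iff_rpow_le one_lt_two (Nat.cast_pos.2 (hM i))).2 (Nat.le_ceil _)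

end Achievability

/-! ### Erasure probabilities above the peak intensity -/

section Congr

variable {N : ℕ} {A E β γ : ℝ} {e e' : (Fin N → Bool) → ℝ}

theorem level_le_of_support {x : Fin N → Bool} {V : Finset (Fin N)}
    (hV : ∑ i ∈ V, (2 : ℝ) ^ (i : ℕ) ≤ γ * A) (hx : ∀ i, x i = true → i ∈ V) :
    level x ≤ γ * A := by
  rw [level, ← sum_filter]
  exact (sum_le_sum_of_subset_of_nonneg (fun i hi => hx i (mem_filter.1 hi).2)
    fun i _ _ => by positivity).trans hV

theorem level_le_of_inputProb_ne_zero {p : Fin N → ℝ} (hp : Feasible A E γ p) {x : Fin N → Bool}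
    (hx : inputProb p x ≠ 0) : level x ≤ γ * A := by
  refine level_le_of_support hp.2.1 fun i hi => mem_filter.2 ⟨mem_univ i, ?_⟩
  have hpi := prod_ne_zero_iff.1 hx i (mem_univ i)
  rw [if_pos hi] at hpi
  exact (hp.1 i).1.lt_of_ne' hpi

theorem cdInfo_congr (h : ∀ x, level x ≤ γ * A → e x = e' x) {p : Fin N → ℝ}
    (hp : Feasible A E γ p) (q : ℕ) (i : Fin N) :
    cdInfo A β γ e q p i = cdInfo A β γ e' q p i := by
  have hjoint : jointLaw A β γ e p = jointLaw A β γ e' p := by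
    funext ω
    unfold jointLaw stateProb
    by_cases hx : inputProb p ω.1 = 0
    · simp only [hx, zero_mul]
    · rw [h _ (level_le_of_inputProb_ne_zero hp hx)]
  rw [cdInfo, cdInfo, hjoint]

theorem CDCode.errorProb_congr (h : ∀ x, level x ≤ γ * A → e x = e' x) {q n : ℕ}
    {c : CDCode N q n} (hc : c.Admissible A E γ) :
    c.errorProb A β γ e = c.errorProb A β γ e' := by
  obtain ⟨⟨V, hV, hoff⟩, -⟩ := hc
  have hlevel : ∀ m t, level (c.word m t) ≤ γ * A := fun m t =>
    level_le_of_support hV fun i => by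
      contrapose!
      exact fun hi => by simp [CDCode.word, (hoff i hi).2]
  unfold CDCode.errorProb stateProb
  simp only [h _ (hlevel _ _)]

theorem cdAchieves_congr (h : ∀ x, level x ≤ γ * A → e x = e' x) {q : ℕ} {r : ℝ} :
    CDAchieves A E β γ e q r ↔ CDAchieves A E β γ e' q r :=
  forall₂_congr fun _ _ => eventually_congr <| Eventually.of_forall fun _ => exists_congr fun _ =>
    and_congr_right fun hc => by rw [CDCode.errorProb_congr h hc]

end Congr

end VBC

theorem theorem5_general {A E β γ ε : ℝ} (hA : 0 ≤ A) (hE : 0 ≤ E) (hβ : 0 < β) (hγ : 0 < γ)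
    (hε : ε < 1) {N : ℕ} (q : ℕ) {e : (Fin N → Bool) → ℝ}
    (he : ∀ x, VBC.level x ≤ γ * A → 0 ≤ e x ∧ e x ≤ ε) :
    ∃ r : ℝ,
      IsGreatest ((fun p : Fin N → ℝ => ∑ i, VBC.cdInfo A β γ e q p i) ''
        {p | VBC.Feasible A E γ p}) r ∧
      VBC.CDAchieves A E β γ e q ((1 - ε) * r) := by
  have hZ := VBC.noiseProb_mem_stdSimplex N hA hβ hγ
  have hε₀ : 0 ≤ ε := by
    have h := he (fun _ => false) (by simpa [VBC.level] using mul_nonneg hγ.le hA)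
    exact h.1.trans h.2
  classical
  let e' : (Fin N → Bool) → ℝ := fun x => if VBC.level x ≤ γ * A then e x else 0
  have hee' : ∀ x, VBC.level x ≤ γ * A → e x = e' x := fun x hx => (if_pos hx).symm
  have he' : ∀ x, 0 ≤ e' x ∧ e' x ≤ ε := fun x => by
    by_cases hx : VBC.level x ≤ γ * A
    · exact hee' x hx ▸ he x hx
    · simpa only [e', if_neg hx] using ⟨le_rfl, hε₀⟩
  have hsum : ∀ p, VBC.Feasible A E γ p →
      ∑ i, VBC.cdInfo A β γ e q p i = ∑ i, VBC.cdInfo A β γ e' q p i := fun p hp =>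
    Finset.sum_congr rfl fun i _ => VBC.cdInfo_congr hee' hp q i
  obtain ⟨p, hp, hmax⟩ := VBC.exists_isMaxOn_sum_cdInfo hA hE hγ.le hZ hε he' q
  refine ⟨_, ⟨⟨p, hp, hsum p hp⟩, ?_⟩,
    (VBC.cdAchieves_congr hee').2 (VBC.cdAchieves_of_feasible hZ hε he' hp q)⟩
  rintro _ ⟨p', hp', rfl⟩
  exact (hsum p' hp').trans_le (hmax hp')

theorem theorem5 (A E β γ : ℝ) (hA : 0 < A) (hE : 0 < E) (hβ : 0 < β) (hγ : 0 < γ)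
    (N : ℕ) (hN : (N : ℤ) = ⌈Real.logb 2 (γ * (A + 2 * β))⌉)
    (q : ℕ) (hq : 1 ≤ q) (hqN : q ≤ N - 1)
    (e : (Fin N → Bool) → ℝ)
    (he : ∀ x, VBC.level x ≤ γ * A → 0 ≤ e x ∧ e x ≤ 2 * VBC.gaussQ β) :
    ∃ r : ℝ,
      IsGreatest ((fun p : Fin N → ℝ => ∑ i, VBC.cdInfo A β γ e q p i) ''
        {p | VBC.Feasible A E γ p}) r ∧
      VBC.CDAchieves A E β γ e q ((1 - 2 * VBC.gaussQ β) * r) :=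
  theorem5_general hA.le hE.le hβ hγ (VBC.two_mul_gaussQ_lt_one hβ) q he
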